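/- Fix a prime $p$ and write $(n)_q = 1 + q + \cdots + q^{n-1}$. Let $R$ be a $\delta$-ring with an element $q$ such that $\delta(q) = 0$ and such that $\mathbb{Z}[q] \to R$ factors through $\mathbb{Z}[q]_{(p,q-1)}$; assume that $R$ is $(p)_q$-torsion free and that $R/(p)_q$ has bounded $p^\infty$-torsion. All modules carry the $(p,q-1)$-adic topology. Let $\phi$ denote Frobenius endomorphisms of $\delta$-rings, $\phi(f) = f^p + p\,\delta(f)$. Let $A$ be a complete $R$-algebra with a topologically étale coordinate $x$ (that is, $R[x] \to A$ is étale modulo every power of $(p,q-1)$), endowed with the unique structure of $\delta$-$R$-algebra such that $\delta(x) = 0$. Let $\sigma$ be the unique endomorphism of the $R$-algebra $A$ such that $\sigma(x) = qx$ and $\sigma \equiv \mathrm{Id} \bmod (q-1)$. For $m = 1$ and $m = p$, let $\partial_{q^m}$ be the unique $R$-linear endomorphism of $A$ such that $\partial_{q^m}(x) = 1$ and $\partial_{q^m}(fg) = \partial_{q^m}(f)\, g + \sigma^m(f)\, \partial_{q^m}(g)$; let $\Omega_{A/R,q^m}$ be the free $A$-module on one generator $\mathrm{d}_{q^m}x$,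 with $\mathrm{d}_{q^m} f = \partial_{q^m}(f)\, \mathrm{d}_{q^m}x$. Let $A'$ be the completion of the scalar extension $R \otimes_{\phi, R} A$ of $A$ along $\phi : R \to R$, seen as an $R$-algebra through the left factor; it has the topologically étale coordinate $x' = 1 \otimes x$, and $\sigma$, $\partial_{q^m}$, $\Omega_{A'/R,q^m}$ are defined for $(A', x')$ as for $(A,x)$. View $A$ as an $A'$-algebra through the relative Frobenius $F : A' \to A$, the continuous map with $F(r \otimes f) = r\,\phi(f)$. Let $M'$ be a complete $A'$-module which is formally flat, i.e. $M'/JM'$ is flat over $A'/J$ for every ideal of definition $J$ of $A'$. Let $\nabla' : M' \to M' \otimes_{A'} \Omega_{A'/R,q^p}$, $\nabla'(s) = \theta'(s) \otimes \mathrm{d}_{q^p}x'$, be an $R$-linear map which is a twisted connection of level $-1$, i.e. $$\nabla'(fs) = (p)_q\, s \otimes \mathrm{d}_{q^p}f + \sigma^p(f)\nabla'(s) \qquad (f \in A',\ s \in M'),$$ and which is topologically quasi-nilpotent, i.e. $\theta'^k(s) \to 0$ for every $s \in M'$. Set $M = A \otimes_{A'} M'$. Then there is a unique $R$-linear map $\nabla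 : M \to M \otimes_A \Omega_{A/R,q}$, $\nabla(s) = \theta(s) \otimes \mathrm{d}_q x$, which is a twisted connection of level $0$, i.e. $\nabla(fs) = s \otimes \mathrm{d}_q f + \sigma(f)\nabla(s)$ for $f \in A$, $s \in M$, and which satisfies $\theta(1 \otimes s) = x^{p-1} \otimes \theta'(s)$ for all $s \in M'$. Moreover, the maps $$M' \to M,\quad s \mapsto 1 \otimes s, \qquad M' \otimes_{A'} \Omega_{A'/R,q^p} \to M \otimes_A \Omega_{A/R,q},\quad s \otimes \mathrm{d}_{q^p}x' \mapsto (x^{p-1} \otimes s) \otimes \mathrm{d}_q x$$ form a quasi-isomorphism of complexes of $R$-modules $$[M' \xrightarrow{\ \nabla'\ } M' \otimes_{A'} \Omega_{A'/R,q^p}] \simeq [M \xrightarrow{\ \nabla\ } M \otimes_A \Omega_{A/R,q}].$$ -/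

import Mathlib

open CategoryTheory
open scoped TensorProduct Polynomial

universe u

/-! ### `δ`-rings and the base ring -/

/-- A `δ`-structure (relative to `p`) on a commutative ring. -/
structure DeltaStructure (p : ℕ) (R : Type*) [CommRing R] where
  /-- The underlying operation. -/
  δ : R → R
  map_zero : δ 0 = 0
  map_one : δ 1 = 0
  /-- `δ (x + y) = δ x + δ y + (x ^ p + y ^ p - (x + y) ^ p) / p`, with the binomial coefficients
  divided by `p` in `ℕ`. -/
  map_add : ∀ x y, δ (x + y) =
    δ x + δ y - ∑ i ∈ Finset.Ioo 0 p, ((p.choose i / p : ℕ) : R) * x ^ i * y ^ (p - i)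
  map_mul : ∀ x y, δ (x * y) = x ^ p * δ y + y ^ p * δ x + (p : R) * δ x * δ y

/-- The Frobenius `φ x = x ^ p + p δ x` of a `δ`-ring. -/
def DeltaStructure.frobenius {p : ℕ} [Fact p.Prime] {R : Type*} [CommRing R]
    (D : DeltaStructure p R) : R →+* R where
  toFun x := x ^ p + (p : R) * D.δ x
  map_one' := by simp [D.map_one]
  map_zero' := by simp [D.map_zero, (Fact.out : p.Prime).ne_zero]
  map_mul' x y := by rw [D.map_mul]; ring
  map_add' x y := by
    have hp : p.Prime := Fact.out
    rw [D.map_add, add_pow_prime_eq hp]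
    have : ∑ i ∈ Finset.Ioo 0 p, ((p.choose i / p : ℕ) : R) * x ^ i * y ^ (p - i) =
        x * y * ∑ k ∈ Finset.Ioo 0 p,
          x ^ (k - 1) * y ^ (p - k - 1) * ((p.choose k / p : ℕ) : R) := by
      rw [Finset.mul_sum]
      refine Finset.sum_congr rfl fun i hi => ?_
      obtain ⟨h0, h1⟩ := Finset.mem_Ioo.mp hi
      obtain ⟨a, rfl⟩ : ∃ a, i = a + 1 := ⟨i - 1, by omega⟩
      obtain ⟨b, hb⟩ : ∃ b, p - (a + 1) = b + 1 := ⟨p - (a + 1) - 1, by omega⟩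
      rw [hb]
      simp only [Nat.add_sub_cancel]
      ring
    rw [this]
    ring

/-- The `q`-analog `(n)_q = 1 + q + ⋯ + q ^ (n - 1)` of a natural number. -/
def qNumber {R : Type*} [CommRing R] (q : R) (n : ℕ) : R := ∑ i ∈ Finset.range n, q ^ i

/-- The hypotheses on the base: `R` is a `δ`-`ℤ[q]_{(p, q - 1)}`-algebra, where `δ q = 0`, which
is bounded with respect to `p` modulo `(p)_q`. -/
structure IsQBase (p : ℕ) {R : Type*} [CommRing R] (D : DeltaStructure p R) (q : R) : Prop where
  delta_q : D.δ q = 0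
  /-- The map `ℤ[q] → R` factors through the local ring of `ℤ[q]` at `(p, q - 1)`. -/
  isUnit_aeval : ∀ f : ℤ[X],
    f ∉ Ideal.span {Polynomial.C (p : ℤ), Polynomial.X - 1} → IsUnit (Polynomial.aeval q f)
  /-- `R` is `(p)_q`-torsion free. -/
  torsionFree : ∀ a : R, qNumber q p * a = 0 → a = 0
  /-- `R / (p)_q` has bounded `p ^ ∞`-torsion. -/
  bounded : ∃ N : ℕ, ∀ (a : R ⧸ Ideal.span {qNumber q p}) (k : ℕ),
    (p : R ⧸ Ideal.span {qNumber q p}) ^ k * a = 0 →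
      (p : R ⧸ Ideal.span {qNumber q p}) ^ N * a = 0

/-- The ideal `(p, q - 1)` of an `R`-algebra `B`. All topologies are adic for this ideal. -/
def qIdeal (p : ℕ) {R : Type*} [CommRing R] (q : R) (B : Type*) [CommRing B] [Algebra R B] :
    Ideal B :=
  Ideal.span {(p : B), algebraMap R B (q - 1)}

/-- The element `x` is a topologically étale coordinate on the (complete) `R`-algebra `A`, for the
`I`-adic topology: the map `R[X] → A`, `X ↦ x`, is étale modulo every power of `I`. -/
def IsTopEtaleCoordinate {R A : Type*} [CommRing R] [CommRing A] [Algebra R A]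
    (I : Ideal R) (x : A) : Prop :=
  ∀ n : ℕ, (Ideal.quotientMap
    (((I ^ n).map (Polynomial.C : R →+* R[X])).map (Polynomial.aeval (R := R) x).toRingHom)
    (Polynomial.aeval (R := R) x).toRingHom Ideal.le_comap_map).Etale

/-- An ideal of definition for the `I`-adic topology of a ring. -/
def IsIdealOfDefinition {B : Type*} [CommRing B] (I J : Ideal B) : Prop :=
  (∃ n : ℕ, I ^ n ≤ J) ∧ ∃ m : ℕ, J ^ m ≤ I

/-- A module is formally flat if it becomes flat modulo any ideal of definition. -/
def IsFormallyFlat {B : Type*} [CommRing B] (I : Ideal B)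
    (M : Type*) [AddCommGroup M] [Module B M] : Prop :=
  ∀ J : Ideal B, IsIdealOfDefinition I J →
    Module.Flat (B ⧸ J) (M ⧸ (J • (⊤ : Submodule B M)))

/-! ### Twisted calculus -/

/-- `σ` is the endomorphism of the `R`-algebra `A` such that `σ x = q x` and `σ ≡ id` modulo
`q - 1`. -/
structure IsQEndomorphism {R A : Type*} [CommRing R] [CommRing A] [Algebra R A]
    (q : R) (x : A) (σ : A →ₐ[R] A) : Prop where
  map_coordinate : σ x = algebraMap R A q * x
  congr_id : ∀ f : A, σ f - f ∈ Ideal.span {algebraMap R A (q - 1)}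

/-- `D` is the twisted derivative attached to the endomorphism `τ` and the coordinate `x`: writing
the module of twisted differential forms as the free module `A · dx`, the universal twisted
differential `d` is given by `d f = D f · dx`. For `τ = σ` (resp. `τ = σ ^ p`) this is the
`q`-derivative (resp. the `q ^ p`-derivative). -/
structure IsTwistedDerivative {R A : Type*} [CommRing R] [CommRing A] [Algebra R A]
    (τ : A →ₐ[R] A) (x : A) (D : A →ₗ[R] A) : Prop where
  leibniz : ∀ f g : A, D (f * g) = D f * g + τ f * D g
  map_coordinate : D x = 1

/-- The operator `θ` on `M` is (in the sense that `∇ s = θ s ⊗ dx`) a twisted connection of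
level `0`: `∇ (f s) = s ⊗ d_q f + σ f ∇ s`. Here `D` is the `q`-derivative. -/
def IsTwistedConnection {R A M : Type*} [CommRing R] [CommRing A] [Algebra R A]
    [AddCommGroup M] [Module R M] [Module A M]
    (σ : A →ₐ[R] A) (D : A →ₗ[R] A) (θ : M →ₗ[R] M) : Prop :=
  ∀ (f : A) (s : M), θ (f • s) = D f • s + σ f • θ s

/-- The operator `θ` on `M` is (in the sense that `∇ s = θ s ⊗ dx`) a twisted connection of
level `-1`: `∇ (f s) = (p)_q s ⊗ d_{q ^ p} f + σ ^ p f ∇ s`. Here `D` is the `q ^ p`-derivative,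
relative to `σ ^ p`. -/
def IsTwistedConnectionNegOne (p : ℕ) {R A M : Type*} [CommRing R] [CommRing A] [Algebra R A]
    [AddCommGroup M] [Module R M] [Module A M]
    (q : R) (σ : A →ₐ[R] A) (D : A →ₗ[R] A) (θ : M →ₗ[R] M) : Prop :=
  ∀ (f : A) (s : M), θ (f • s) = qNumber q p • (D f • s) + (σ ^ p) f • θ s

/-- `θ ^ k s → 0` for all `s`, in the `I`-adic topology of `M`. -/
def IsTopQuasiNilpotent {R B M : Type*} [CommRing R] [CommRing B] [AddCommGroup M] [Module R M]
    [Module B M] (I : Ideal B) (θ : M →ₗ[R] M) : Prop :=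
  ∀ (s : M) (n : ℕ), ∃ K : ℕ, ∀ k : ℕ, K ≤ k → (θ ^ k) s ∈ (I ^ n • (⊤ : Submodule B M))

/-! ### The Frobenius pullback `A' = R ⊗̂_{φ, R} A` and the relative Frobenius `A' → A` -/

/-- The ring `S`, seen as an `R`-algebra through `f : R →+* S`. -/
def AlgebraVia {R S : Type*} [CommRing R] [CommRing S] (_f : R →+* S) : Type _ := S

instance {R S : Type*} [CommRing R] [CommRing S] (f : R →+* S) : CommRing (AlgebraVia f) :=
  inferInstanceAs (CommRing S)

instance {R S : Type*} [CommRing R] [CommRing S] (f : R →+* S) : Algebra R (AlgebraVia f) :=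
  f.toAlgebra

/-- The identity map from `S` to `AlgebraVia f`. -/
def AlgebraVia.of {R S : Type*} [CommRing R] [CommRing S] (f : R →+* S) : S →+* AlgebraVia f :=
  RingHom.id S

/-- The identity map from `AlgebraVia f` to `S`. -/
def AlgebraVia.val {R S : Type*} [CommRing R] [CommRing S] (f : R →+* S) : AlgebraVia f →+* S :=
  RingHom.id S

section FrobeniusPullback

variable {p : ℕ} [Fact p.Prime] {R : Type u} [CommRing R] (δR : DeltaStructure p R) (q : R)
  (A : Type u) [CommRing A] [Algebra R A]

/-- The tensor product `R ⊗_{φ, R} A` before completion. -/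
abbrev UncompletedPullback : Type u := AlgebraVia δR.frobenius ⊗[R] A

/-- The structural map `r ↦ r ⊗ 1` of `R ⊗_{φ, R} A`. -/
def UncompletedPullback.scalar : R →+* UncompletedPullback δR A :=
  (Algebra.TensorProduct.includeLeftRingHom :
    AlgebraVia δR.frobenius →+* AlgebraVia δR.frobenius ⊗[R] A).comp
      (AlgebraVia.of δR.frobenius)

/-- The ideal `(p, q - 1)` of `R ⊗_{φ, R} A`, where `q` stands for `q ⊗ 1`. -/
def UncompletedPullback.ideal : Ideal (UncompletedPullback δR A) :=
  Ideal.span {(p : UncompletedPullback δR A), UncompletedPullback.scalar δR A (q - 1)}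

/-- The completed pullback `A' = R ⊗̂_{φ, R} A` of `A` along the Frobenius of `R`. -/
def FrobeniusPullback : Type u :=
  AdicCompletion (UncompletedPullback.ideal δR q A) (UncompletedPullback δR A)

noncomputable instance : CommRing (FrobeniusPullback δR q A) :=
  inferInstanceAs (CommRing
    (AdicCompletion (UncompletedPullback.ideal δR q A) (UncompletedPullback δR A)))

/-- The canonical map `R ⊗_{φ, R} A → A'`. -/
noncomputable def FrobeniusPullback.of : UncompletedPullback δR A →+* FrobeniusPullback δR q A :=
  algebraMap (UncompletedPullback δR A)
    (AdicCompletion (UncompletedPullback.ideal δR q A) (UncompletedPullback δR A))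

/-- The canonical map from `A'` to the quotient of `R ⊗_{φ, R} A` by the `n`-th power of the
ideal `(p, q - 1)`. -/
noncomputable def FrobeniusPullback.eval (n : ℕ) : FrobeniusPullback δR q A →+*
    UncompletedPullback δR A ⧸ UncompletedPullback.ideal δR q A ^ n :=
  (AdicCompletion.evalₐ (UncompletedPullback.ideal δR q A) n).toRingHom

theorem FrobeniusPullback.eval_of (n : ℕ) (b : UncompletedPullback δR A) :
    FrobeniusPullback.eval δR q A n (FrobeniusPullback.of δR q A b) = Ideal.Quotient.mk _ b :=
  AdicCompletion.evalₐ_of (UncompletedPullback.ideal δR q A) n b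

theorem FrobeniusPullback.exists_eval_eq {m n : ℕ} (hle : m ≤ n) (z : FrobeniusPullback δR q A) :
    ∃ b : UncompletedPullback δR A, FrobeniusPullback.eval δR q A n z = Ideal.Quotient.mk _ b ∧
      FrobeniusPullback.eval δR q A m z = Ideal.Quotient.mk _ b := by
  obtain ⟨y, rfl⟩ := AdicCompletion.mk_surjective _ _ z
  exact ⟨y n, AdicCompletion.evalₐ_mk (UncompletedPullback.ideal δR q A) n y,
    (AdicCompletion.evalₐ_mk (UncompletedPullback.ideal δR q A) m y).trans
      (AdicCompletion.Ideal.mk_eq_mk _ hle y).symm⟩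

/-- `A'` is an `R`-algebra through `r ↦ r ⊗ 1`. -/
noncomputable instance : Algebra R (FrobeniusPullback δR q A) :=
  ((FrobeniusPullback.of δR q A).comp (UncompletedPullback.scalar δR A)).toAlgebra

variable {A}

/-- The map `a ↦ 1 ⊗ a` from `A` to `A'`. -/
noncomputable def FrobeniusPullback.incl (a : A) : FrobeniusPullback δR q A :=
  FrobeniusPullback.of δR q A (1 ⊗ₜ[R] a)

/-- The uncompleted relative Frobenius `R ⊗_{φ, R} A → A`, `r ⊗ a ↦ r φ a`. -/
noncomputable def uncompletedFrobenius (δA : DeltaStructure p A)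
    (hδ : ∀ r : R, δA.δ (algebraMap R A r) = algebraMap R A (δR.δ r)) :
    UncompletedPullback δR A →+* A :=
  (AlgebraVia.val (δA.frobenius.comp (algebraMap R A))).comp
    (Algebra.TensorProduct.lift
      ({ (AlgebraVia.of (δA.frobenius.comp (algebraMap R A))).comp
          ((algebraMap R A).comp (AlgebraVia.val δR.frobenius)) with
        commutes' := fun r => by
          change algebraMap R A (r ^ p + (p : R) * δR.δ r) =
            (algebraMap R A r) ^ p + (p : A) * δA.δ (algebraMap R A r)
          rw [hδ]; simp } :
        AlgebraVia δR.frobenius →ₐ[R] AlgebraVia (δA.frobenius.comp (algebraMap R A)))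
      ({ (AlgebraVia.of (δA.frobenius.comp (algebraMap R A))).comp δA.frobenius with
        commutes' := fun _ => rfl } :
        A →ₐ[R] AlgebraVia (δA.frobenius.comp (algebraMap R A)))
      (fun _ _ => Commute.all _ _)).toRingHom

theorem uncompletedFrobenius_tmul (δA : DeltaStructure p A)
    (hδ : ∀ r : R, δA.δ (algebraMap R A r) = algebraMap R A (δR.δ r)) (r : R) (a : A) :
    uncompletedFrobenius δR δA hδ (AlgebraVia.of δR.frobenius r ⊗ₜ[R] a) =
      algebraMap R A r * δA.frobenius a :=
  rfl

theorem uncompletedFrobenius_scalar (δA : DeltaStructure p A)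
    (hδ : ∀ r : R, δA.δ (algebraMap R A r) = algebraMap R A (δR.δ r)) (r : R) :
    uncompletedFrobenius δR δA hδ (UncompletedPullback.scalar δR A r) = algebraMap R A r := by
  have := uncompletedFrobenius_tmul δR δA hδ r 1
  rw [_root_.map_one, mul_one] at this
  exact this

theorem map_ideal_le (δA : DeltaStructure p A)
    (hδ : ∀ r : R, δA.δ (algebraMap R A r) = algebraMap R A (δR.δ r)) :
    (UncompletedPullback.ideal δR q A).map (uncompletedFrobenius δR δA hδ) ≤ qIdeal p q A := by
  rw [UncompletedPullback.ideal, Ideal.map_span, Ideal.span_le]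
  rintro _ ⟨y, rfl | rfl, rfl⟩
  · rw [map_natCast]
    exact Ideal.subset_span (Set.mem_insert _ _)
  · rw [uncompletedFrobenius_scalar]
    exact Ideal.subset_span (Set.mem_insert_of_mem _ rfl)

theorem ideal_pow_le_comap (δA : DeltaStructure p A)
    (hδ : ∀ r : R, δA.δ (algebraMap R A r) = algebraMap R A (δR.δ r)) (n : ℕ) :
    UncompletedPullback.ideal δR q A ^ n ≤
      (qIdeal p q A ^ n).comap (uncompletedFrobenius δR δA hδ) := by
  rw [← Ideal.map_le_iff_le_comap, Ideal.map_pow]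
  exact Ideal.pow_right_mono (map_ideal_le δR q δA hδ) n

theorem relativeFrobenius_compat (δA : DeltaStructure p A)
    (hδ : ∀ r : R, δA.δ (algebraMap R A r) = algebraMap R A (δR.δ r)) {m n : ℕ} (hle : m ≤ n) :
    (Ideal.Quotient.factorPow (qIdeal p q A) hle).comp
      ((Ideal.quotientMap (qIdeal p q A ^ n) (uncompletedFrobenius δR δA hδ)
        (ideal_pow_le_comap δR q δA hδ n)).comp
          (FrobeniusPullback.eval δR q A n)) =
      (Ideal.quotientMap (qIdeal p q A ^ m) (uncompletedFrobenius δR δA hδ)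
        (ideal_pow_le_comap δR q δA hδ m)).comp
          (FrobeniusPullback.eval δR q A m) := by
  refine RingHom.ext fun z => ?_
  obtain ⟨b, h1, h2⟩ := FrobeniusPullback.exists_eval_eq δR q A hle z
  rw [RingHom.comp_apply, RingHom.comp_apply, RingHom.comp_apply, h1, h2]
  rfl

/-- The relative Frobenius `F : A' → A`, the continuous extension of `r ⊗ a ↦ r φ a`. -/
noncomputable def relativeFrobenius [IsAdicComplete (qIdeal p q A) A] (δA : DeltaStructure p A)
    (hδ : ∀ r : R, δA.δ (algebraMap R A r) = algebraMap R A (δR.δ r)) :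
    FrobeniusPullback δR q A →+* A :=
  IsAdicComplete.liftRingHom (qIdeal p q A)
    (fun n => (Ideal.quotientMap (qIdeal p q A ^ n) (uncompletedFrobenius δR δA hδ)
      (ideal_pow_le_comap δR q δA hδ n)).comp
        (FrobeniusPullback.eval δR q A n))
    (relativeFrobenius_compat δR q δA hδ)

theorem relativeFrobenius_of [IsAdicComplete (qIdeal p q A) A] (δA : DeltaStructure p A)
    (hδ : ∀ r : R, δA.δ (algebraMap R A r) = algebraMap R A (δR.δ r))
    (b : UncompletedPullback δR A) :
    relativeFrobenius δR q δA hδ (FrobeniusPullback.of δR q A b) =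
      uncompletedFrobenius δR δA hδ b := by
  refine (IsHausdorff.eq_iff_smodEq (I := qIdeal p q A)).mpr fun n => ?_
  rw [smul_eq_mul, Ideal.mul_top]
  refine (IsAdicComplete.mk_liftRingHom (qIdeal p q A) _
    (relativeFrobenius_compat δR q δA hδ) n _).trans ?_
  exact congrArg (Ideal.quotientMap (qIdeal p q A ^ n) (uncompletedFrobenius δR δA hδ)
    (ideal_pow_le_comap δR q δA hδ n)) (FrobeniusPullback.eval_of δR q A n b)

/-- The relative Frobenius is a morphism of `R`-algebras. -/
theorem relativeFrobenius_algebraMap [IsAdicComplete (qIdeal p q A) A] (δA : DeltaStructure p A)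
    (hδ : ∀ r : R, δA.δ (algebraMap R A r) = algebraMap R A (δR.δ r)) (r : R) :
    relativeFrobenius δR q δA hδ (algebraMap R (FrobeniusPullback δR q A) r) =
      algebraMap R A r :=
  (relativeFrobenius_of δR q δA hδ _).trans (uncompletedFrobenius_scalar δR δA hδ r)

/-- The relative Frobenius sends `1 ⊗ a` to `φ a`. -/
theorem relativeFrobenius_incl [IsAdicComplete (qIdeal p q A) A] (δA : DeltaStructure p A)
    (hδ : ∀ r : R, δA.δ (algebraMap R A r) = algebraMap R A (δR.δ r)) (a : A) :
    relativeFrobenius δR q δA hδ (FrobeniusPullback.incl δR q a) = δA.frobenius a := by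
  rw [FrobeniusPullback.incl, relativeFrobenius_of]
  have := uncompletedFrobenius_tmul δR δA hδ 1 a
  rw [_root_.map_one, _root_.map_one, one_mul] at this
  exact this

end FrobeniusPullback

/-! ### Two-term complexes -/

theorem up_rel_zero_one : (ComplexShape.up ℕ).Rel 0 1 := rfl

/-- The cochain complex `[M₀ → M₁]` of `R`-modules, in degrees `0` and `1`. -/
noncomputable abbrev twoTermComplex {R : Type u} [CommRing R] {M₀ M₁ : Type u}
    [AddCommGroup M₀] [AddCommGroup M₁] [Module R M₀] [Module R M₁] (d : M₀ →ₗ[R] M₁) :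
    CochainComplex (ModuleCat.{u} R) ℕ :=
  HomologicalComplex.double (ModuleCat.ofHom d) (c := ComplexShape.up ℕ) (i₀ := 0) (i₁ := 1) up_rel_zero_one

/-- The morphism of complexes `[M₀ → M₁] ⟶ [N₀ → N₁]` given by a commutative square. -/
noncomputable def twoTermMap {R : Type u} [CommRing R] {M₀ M₁ N₀ N₁ : Type u}
    [AddCommGroup M₀] [AddCommGroup M₁] [AddCommGroup N₀] [AddCommGroup N₁]
    [Module R M₀] [Module R M₁] [Module R N₀] [Module R N₁]
    (d : M₀ →ₗ[R] M₁) (e : N₀ →ₗ[R] N₁) (f₀ : M₀ →ₗ[R] N₀) (f₁ : M₁ →ₗ[R] N₁)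
    (comm : ∀ s, e (f₀ s) = f₁ (d s)) : twoTermComplex d ⟶ twoTermComplex e :=
  HomologicalComplex.mkHomFromDouble (c := ComplexShape.up ℕ) (i₀ := 0) (i₁ := 1) up_rel_zero_one zero_ne_one
    (ModuleCat.ofHom f₀ ≫ (HomologicalComplex.doubleXIso₀ (ModuleCat.ofHom e) _).inv)
    (ModuleCat.ofHom f₁ ≫ (HomologicalComplex.doubleXIso₁ (ModuleCat.ofHom e) _ zero_ne_one).inv)
    (by
      have h : ModuleCat.ofHom f₀ ≫ ModuleCat.ofHom e = ModuleCat.ofHom d ≫ ModuleCat.ofHom f₁ := by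
        ext s; exact comm s
      rw [HomologicalComplex.double_d _ _ zero_ne_one]
      simp [reassoc_of% h])
    (fun k _ => by
      rw [HomologicalComplex.double_d_eq_zero₀ _ _ _ _ one_ne_zero, Limits.comp_zero])

/-- The map `M' → A ⊗ M'`, `s ↦ a ⊗ s`, for a fixed `a` in `A`. -/
def tensorLeft (R : Type*) {B A M : Type*} [CommRing R] [CommRing B] [CommRing A] [Algebra R B]
    [Algebra R A] [Algebra B A] [IsScalarTower R B A] [AddCommGroup M] [Module R M] [Module B M]
    [IsScalarTower R B M] (a : A) : M →ₗ[R] A ⊗[B] M :=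
  (TensorProduct.mk B A M a).restrictScalars R

/-! ### Consequences of étaleness: rigidity, lifting, and `p`-th powers. -/

section FormallyUnramified

variable {S A : Type*} [CommRing S] [CommRing A]

/-! The relative Frobenius makes `A` free over `A'` with basis `1, x, …, x ^ (p - 1)`, where `x ^ p`
is the image of `x'`. Hence `M` is the direct sum of the `x ^ i ⊗ M'`. The two Leibniz rules give `θ
(1 ⊗ s) = x ^ (p - 1) ⊗ θ' s` and, for `0 < i < p`, `θ (x ^ i ⊗ s) = x ^ (i - 1) ⊗ ((i)_q s + q ^ i
x' θ' s)`. So the complex of `M` splits into the complex of `M'`, sitting on `1` and `x ^ (p - 1)`,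
and the `p - 1` complexes `x ^ i ⊗ M' → x ^ (i - 1) ⊗ M'`. There `(i)_q` is a unit of `R` and `x'
θ'` is topologically nilpotent, so the differential is bijective and these summands are contractible
(`exists_contraction`).

Freeness (`exists_basis_relativeFrobenius`) is proved modulo each power of `(p, q - 1)` by comparing
`A` with `A'[T] / (T ^ p - x')`. The latter maps onto `A / (p, q - 1)` with nilpotent kernel, and
étaleness of `x` lifts `A → A / (p, q - 1)` to a section sending `x` to `T`
(`PullbackRoot.exists_section`).

For existence and uniqueness of `∇`, the formula for `θ` on pure tensors is forced. It is
`A'`-balanced because `σ ∘ F = F ∘ σ ^ p` and `∂_q ∘ F = (p)_q x ^ (p - 1) F ∘ ∂_{q ^ p}`: the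
factor `(p)_q` is the one in the Leibniz rule of level `-1`. Both identities, and also the
compatibility of the section with Frobenius, come from one rigidity principle
(`mem_pow_of_twisted_derivation`): a twisted derivation vanishing on `R[x]` is topologically zero.
-/

theorem Derivation.eq_zero_of_formallyUnramified_quotient [Algebra S A] (K : Ideal A)
    [Algebra.FormallyUnramified S (A ⧸ K)] {N : Type*} [AddCommGroup N] [Module A N] [Module S N]
    [IsScalarTower S A N] (hN : ∀ a ∈ K, ∀ n : N, a • n = 0) (d : Derivation S A N)
    (hd : ∀ a ∈ K, d a = 0) : d = 0 := by
  let : Module (A ⧸ K) N := Module.IsTorsionBySet.module (fun n a => hN a a.2 n)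
  have hmk : ∀ (a : A) (n : N), (Ideal.Quotient.mk K a) • n = a • n := fun _ _ => rfl
  have : IsScalarTower A (A ⧸ K) N := ⟨fun a b n => by
    obtain ⟨b, rfl⟩ := Ideal.Quotient.mk_surjective b
    rw [Algebra.smul_def, Ideal.Quotient.algebraMap_eq, ← _root_.map_mul, hmk, hmk, mul_smul]⟩
  have : IsScalarTower S (A ⧸ K) N := ⟨fun a b n => by
    obtain ⟨b, rfl⟩ := Ideal.Quotient.mk_surjective b
    rw [← algebraMap_smul A a (Ideal.Quotient.mk K b), smul_assoc, algebraMap_smul]⟩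
  let l : (A ⧸ K) →ₗ[S] N := (K.restrictScalars S).liftQ d.toLinearMap hd
  have hl : ∀ a, l (Ideal.Quotient.mk K a) = d a := fun _ => rfl
  let d' : Derivation S (A ⧸ K) N := Derivation.mk' l fun a b => by
    obtain ⟨a, rfl⟩ := Ideal.Quotient.mk_surjective a
    obtain ⟨b, rfl⟩ := Ideal.Quotient.mk_surjective b
    rw [← _root_.map_mul, hl, hl, hl, hmk, hmk, d.leibniz]
  have h0 : d' = 0 := by
    have : Subsingleton (Derivation S (A ⧸ K) N) :=
      (KaehlerDifferential.linearMapEquivDerivation S (A ⧸ K)).symm.injective.subsingleton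
    exact Subsingleton.elim _ _
  ext a
  rw [← hl]
  exact DFunLike.congr_fun h0 _

/-- Once `E` lands in `J ^ n`, its reduction takes values in `J ^ n / J ^ (n + 1)`, where `ψ₁` and
`ψ₂` act in the same way. It is therefore an honest derivation, and unramifiedness kills it. Since a
difference of two ring homomorphisms is a twisted derivation, this also serves to prove that such
homomorphisms agree. -/
theorem mem_pow_of_twisted_derivation {C : Type*} [CommRing C] (f : S →+* A) (L : Ideal S)
    (hf : (Ideal.quotientMap (L.map f) f Ideal.le_comap_map).FormallyUnramified)
    (J : Ideal C) (ψ₁ ψ₂ : A →+* C) (hψ : ∀ a, ψ₂ a - ψ₁ a ∈ J) (hL : ∀ s ∈ L, ψ₁ (f s) ∈ J)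
    (E : A →+ C) (hmul : ∀ a b, E (a * b) = E a * ψ₁ b + ψ₂ a * E b) (hE : ∀ s, E (f s) = 0)
    (n : ℕ) (a : A) : E a ∈ J ^ n := by
  induction n generalizing a with
  | zero => simp
  | succ n ih =>
    let := f.toAlgebra
    let : Algebra A C := ψ₁.toAlgebra
    let : Algebra S C := (ψ₁.comp f).toAlgebra
    have : IsScalarTower S A C := IsScalarTower.of_algebraMap_eq fun _ => rfl
    let K : Ideal A := L.map (algebraMap S A)
    have : Algebra.FormallyUnramified S (A ⧸ K) := by
      let := (Ideal.quotientMap (L.map f) f Ideal.le_comap_map).toAlgebra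
      have : Algebra.FormallyUnramified (S ⧸ L) (A ⧸ K) := hf
      have : IsScalarTower S (S ⧸ L) (A ⧸ K) := IsScalarTower.of_algebraMap_eq fun _ => rfl
      exact Algebra.FormallyUnramified.comp S (S ⧸ L) (A ⧸ K)
    let N : Submodule C (C ⧸ J ^ (n + 1)) := Submodule.map (J ^ (n + 1)).mkQ (J ^ n)
    have hJN : ∀ c ∈ J, ∀ m ∈ N, c • m = 0 := by
      rintro c hc _ ⟨m, hm, rfl⟩
      rw [← map_smul, Submodule.mkQ_apply, Submodule.Quotient.mk_eq_zero, pow_succ', smul_eq_mul]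
      exact Ideal.mul_mem_mul hc hm
    have hKJ : ∀ a ∈ K, ψ₁ a ∈ J := by
      have : K ≤ J.comap ψ₁ := Ideal.map_le_iff_le_comap.mpr hL
      exact this
    have hEs : ∀ s b, E (f s * b) = ψ₂ (f s) * E b := fun s b => by rw [hmul, hE]; ring
    let e : A → N := fun a => ⟨(J ^ (n + 1)).mkQ (E a), E a, ih a, rfl⟩
    have hψN : ∀ a (m : N), ψ₂ a • m = ψ₁ a • m := fun a m => by
      refine Subtype.ext (sub_eq_zero.mp ?_)
      exact (sub_smul (ψ₂ a) (ψ₁ a) (m : C ⧸ J ^ (n + 1))).symm.trans (hJN _ (hψ a) m m.2)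
    let d : Derivation S A N := Derivation.mk'
      { toFun := e
        map_add' := fun a b => Subtype.ext (by simp [e])
        map_smul' := fun s b => by
          change e (f s * b) = ψ₁ (f s) • e b
          rw [← hψN]
          refine Subtype.ext ?_
          change (J ^ (n + 1)).mkQ (E (f s * b)) = ψ₂ (f s) • (J ^ (n + 1)).mkQ (E b)
          rw [hEs, ← smul_eq_mul, map_smul] }
      (fun a b => by
        change e (a * b) = ψ₁ a • e b + ψ₁ b • e a
        rw [← hψN]
        refine Subtype.ext ?_
        change (J ^ (n + 1)).mkQ (E (a * b)) = ψ₂ a • (J ^ (n + 1)).mkQ (E b) +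
          ψ₁ b • (J ^ (n + 1)).mkQ (E a)
        rw [hmul, ← LinearMap.map_smul, ← LinearMap.map_smul, ← _root_.map_add, smul_eq_mul,
          smul_eq_mul, mul_comm (E a), add_comm (ψ₁ b * E a)])
    have hd0 : d = 0 := by
      refine Derivation.eq_zero_of_formallyUnramified_quotient K ?_ d ?_
      · exact fun a ha m => Subtype.ext (hJN _ (hKJ a ha) m m.2)
      -- `K` is generated by the image of `S`, where `d` vanishes, and its elements act by zero on
      -- `N`, so the Leibniz rule propagates the vanishing.
      · intro a ha
        refine Submodule.span_induction (p := fun a _ => d a = 0) ?_ (map_zero d)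
          (fun _ _ _ _ h1 h2 => by rw [_root_.map_add, h1, h2, add_zero]) ?_ ha
        · rintro _ ⟨s, -, rfl⟩
          refine Subtype.ext ?_
          change (J ^ (n + 1)).mkQ (E (f s)) = 0
          rw [hE, _root_.map_zero]
        · intro b c hc h
          rw [smul_eq_mul, d.leibniz, h, smul_zero, zero_add]
          exact Subtype.ext (hJN _ (hKJ c hc) _ (d b).2)
    have := congrArg Subtype.val (DFunLike.congr_fun hd0 a)
    exact (Submodule.Quotient.mk_eq_zero _).mp this

theorem exists_ringHom_lift_of_etale_quotient {B : Type*} [CommRing B] (f : S →+* A) (L : Ideal S)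
    (hf : (Ideal.quotientMap (L.map f) f Ideal.le_comap_map).Etale)
    (J : Ideal B) (hJ : IsNilpotent J) (g : S →+* B) (hg : ∀ s ∈ L, g s = 0)
    (h : A →+* B ⧸ J) (hgh : ∀ s, h (f s) = Ideal.Quotient.mk J (g s)) :
    ∃ l : A →+* B, (∀ s, l (f s) = g s) ∧ ∀ a, Ideal.Quotient.mk J (l a) = h a := by
  let := (Ideal.quotientMap (L.map f) f Ideal.le_comap_map).toAlgebra
  let := (Ideal.Quotient.lift L g hg).toAlgebra
  have : Algebra.Etale (S ⧸ L) (A ⧸ L.map f) := hf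
  have hK : ∀ a ∈ L.map f, h a = 0 := by
    have : L.map f ≤ RingHom.ker h := by
      rw [Ideal.map_le_iff_le_comap]
      intro s hs
      rw [Ideal.mem_comap, RingHom.mem_ker, hgh, hg s hs, _root_.map_zero]
    exact this
  let h' : (A ⧸ L.map f) →ₐ[S ⧸ L] B ⧸ J :=
    { Ideal.Quotient.lift (L.map f) h hK with
      commutes' := fun s => by
        obtain ⟨s, rfl⟩ := Ideal.Quotient.mk_surjective s
        exact hgh s }
  obtain ⟨l, hl⟩ := Algebra.FormallySmooth.exists_lift J hJ h'
  refine ⟨(l : (A ⧸ L.map f) →+* B).comp (Ideal.Quotient.mk _), fun s => ?_, fun a => ?_⟩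
  · exact l.commutes (Ideal.Quotient.mk L s)
  · exact DFunLike.congr_fun hl (Ideal.Quotient.mk _ a)

/-- `A` is integral and of finite type over `A₀`, hence finite. The kernel of `A ⊗ A → A` over `A₀`
is idempotent by unramifiedness, and nilpotent because `(1 ⊗ a - a ⊗ 1) ^ p = 1 ⊗ a ^ p - a ^ p ⊗ 1
= 0` in characteristic `p`. So it vanishes, `A₀ → A` is an epimorphism, and a finite epimorphism is
surjective. -/
theorem Subring.eq_top_of_pow_mem_of_unramified {p : ℕ} [Fact p.Prime] (hp : (p : A) = 0) (f : S →+* A)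
    (hf : f.FormallyUnramified) (hf' : f.FiniteType) (A₀ : Subring A) (hS : ∀ s, f s ∈ A₀)
    (hpow : ∀ a, a ^ p ∈ A₀) : A₀ = ⊤ := by
  let := f.toAlgebra
  let : Algebra S A₀ := (f.codRestrict A₀ hS).toAlgebra
  have : IsScalarTower S A₀ A := IsScalarTower.of_algebraMap_eq fun _ => rfl
  have : Algebra.FormallyUnramified S A := hf
  have : Algebra.FiniteType S A := hf'
  have : Algebra.FormallyUnramified A₀ A := .of_restrictScalars S A₀ A
  have : Algebra.FiniteType A₀ A := .of_restrictScalars_finiteType S A₀ A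
  have : Algebra.IsIntegral A₀ A := ⟨fun a => by
    refine IsIntegral.of_pow (Fact.out : p.Prime).pos ?_
    exact isIntegral_algebraMap (R := A₀) (x := ⟨a ^ p, hpow a⟩)⟩
  have : Module.Finite A₀ A := Algebra.IsIntegral.finite
  have hsurj : Function.Surjective (algebraMap A₀ A) := by
    rw [← Algebra.isEpi_iff_surjective_algebraMap_of_finite]
    have hI : KaehlerDifferential.ideal A₀ A = ⊥ := by
      have hfg := KaehlerDifferential.ideal_fg A₀ A
      have hid : IsIdempotentElem (KaehlerDifferential.ideal A₀ A) :=
        (Ideal.cotangent_subsingleton_iff _).mp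
          (inferInstanceAs (Subsingleton (Ω[A⁄A₀])))
      have hnil : IsNilpotent (KaehlerDifferential.ideal A₀ A) := by
        rw [Ideal.FG.isNilpotent_iff_le_nilradical hfg, ← KaehlerDifferential.span_range_eq_ideal,
          Ideal.span_le]
        rintro _ ⟨a, rfl⟩
        refine ⟨p, ?_⟩
        obtain ⟨r, hr⟩ := exists_add_pow_prime_eq (Fact.out : p.Prime)
          ((1 : A) ⊗ₜ[A₀] a - a ⊗ₜ[A₀] (1 : A)) (a ⊗ₜ[A₀] (1 : A))
        have hp' : (p : A ⊗[A₀] A) = 0 := by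
          rw [← map_natCast (algebraMap A (A ⊗[A₀] A)), hp, _root_.map_zero]
        have ha : (1 : A) ⊗ₜ[A₀] (a ^ p) = (a ^ p) ⊗ₜ[A₀] (1 : A) := by
          have h1 : a ^ p = (⟨a ^ p, hpow a⟩ : A₀) • (1 : A) := (mul_one _).symm
          rw [h1, TensorProduct.tmul_smul, TensorProduct.smul_tmul']
        rw [sub_add_cancel, Algebra.TensorProduct.tmul_pow, Algebra.TensorProduct.tmul_pow,
          one_pow, ha, hp', zero_mul, zero_mul, zero_mul, add_zero] at hr
        exact right_eq_add.mp hr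
      obtain ⟨n, hn⟩ := hnil
      rw [← Ideal.zero_eq_bot, ← hn]
      -- Idempotence gives `I ^ n = I` only for positive `n`; for `n = 0` the nilpotence relation
      -- says that the ring is trivial.
      rcases Nat.eq_zero_or_pos n with rfl | h0
      · rw [pow_zero] at hn ⊢
        exact (Submodule.eq_bot_iff _).mpr (fun z _ => by
          have : z ∈ (1 : Ideal (A ⊗[A₀] A)) := by rw [Ideal.one_eq_top]; trivial
          rw [hn] at this
          exact this) |>.trans hn.symm
      · exact (hid.pow_eq h0.ne').symm
    rw [Algebra.isEpi_iff_forall_one_tmul_eq]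
    intro a
    have := KaehlerDifferential.one_smul_sub_smul_one_mem_ideal A₀ a
    rw [hI] at this
    exact sub_eq_zero.mp this
  rw [eq_top_iff]
  intro a _
  obtain ⟨b, rfl⟩ := hsurj a
  exact b.2

/-- The kernel is the image of the kernel of a polynomial presentation of `A` that factors through
`B`. -/
theorem RingHom.FinitePresentation.ker_fg_of_comp {B : Type*} [CommRing B] (g : S →+* B)
    (hg : g.FiniteType) (π : B →+* A) (hπ : Function.Surjective π)
    (h : (π.comp g).FinitePresentation) : (RingHom.ker π).FG := by
  let := g.toAlgebra
  let := (π.comp g).toAlgebra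
  have : Algebra.FinitePresentation S A := h
  have : Algebra.FiniteType S B := hg
  obtain ⟨n, r, hr⟩ := Algebra.FiniteType.iff_quotient_mvPolynomial''.mp ‹Algebra.FiniteType S B›
  let π' : B →ₐ[S] A := { π with commutes' := fun _ => rfl }
  have h1 := Algebra.FinitePresentation.ker_fg_of_mvPolynomial (π'.comp r) (hπ.comp hr)
  have h2 := h1.map r.toRingHom
  have h3 : RingHom.ker π = (RingHom.ker (π'.comp r).toRingHom).map r.toRingHom := by
    refine le_antisymm (fun b hb => ?_) (Ideal.map_le_iff_le_comap.mpr fun m hm => hm)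
    obtain ⟨m, rfl⟩ := hr b
    exact Ideal.mem_map_of_mem r.toRingHom hb
  rw [h3]
  exact h2

end FormallyUnramified

/-! ### Frobenius in characteristic `p` and adjoining a `p`-th root. -/

/-- The `p`-power endomorphism of a ring in which the prime `p` vanishes. -/
def powPrimeHom {p : ℕ} [Fact p.Prime] {B : Type*} [CommRing B] (h : (p : B) = 0) : B →+* B where
  toFun b := b ^ p
  map_one' := one_pow p
  map_zero' := zero_pow (Fact.out : p.Prime).ne_zero
  map_mul' a b := mul_pow a b p
  map_add' a b := by
    obtain ⟨r, hr⟩ := exists_add_pow_prime_eq (Fact.out : p.Prime) a b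
    rw [hr, h]
    ring

section XPowSubC

variable {B : Type*} [CommRing B] {p : ℕ} (c : B)

theorem AdjoinRoot.exists_eq_sum_X_pow_sub_C (hp : p ≠ 0) (z : AdjoinRoot (.X ^ p - .C c : B[X])) :
    ∃ b : Fin p → B, z = ∑ i, AdjoinRoot.of _ (b i) * AdjoinRoot.root _ ^ (i : ℕ) := by
  rcases subsingleton_or_nontrivial B with h | h
  · have : Subsingleton (AdjoinRoot (.X ^ p - .C c : B[X])) := Module.subsingleton B _
    exact ⟨0, Subsingleton.elim _ _⟩
  obtain ⟨g, rfl⟩ := AdjoinRoot.mk_surjective z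
  have hm : (.X ^ p - .C c : B[X]).Monic := Polynomial.monic_X_pow_sub_C c hp
  have hdeg : (g %ₘ (.X ^ p - .C c : B[X])).degree < p := by
    have := Polynomial.degree_modByMonic_lt g hm
    rwa [Polynomial.degree_X_pow_sub_C (Nat.pos_of_ne_zero hp)] at this
  refine ⟨fun i => (g %ₘ (.X ^ p - .C c : B[X])).coeff i, ?_⟩
  have h1 : AdjoinRoot.mk (.X ^ p - .C c : B[X]) g = AdjoinRoot.mk _ (g %ₘ (.X ^ p - .C c : B[X])) := by
    rw [AdjoinRoot.mk_eq_mk]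
    exact ⟨g /ₘ (.X ^ p - .C c : B[X]), by
      nth_rewrite 1 [← Polynomial.modByMonic_add_div g (.X ^ p - .C c : B[X])]; ring⟩
  rw [h1]
  nth_rewrite 1 [← Polynomial.sum_C_mul_X_pow_eq (g %ₘ (.X ^ p - .C c : B[X])),
    ← Polynomial.sum_fin _ (by simp) hdeg]
  rw [_root_.map_sum]
  refine Finset.sum_congr rfl fun i _ => ?_
  rw [_root_.map_mul, AdjoinRoot.mk_C, _root_.map_pow, AdjoinRoot.mk_X]

theorem AdjoinRoot.eq_zero_of_sum_X_pow_sub_C (b : Fin p → B)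
    (h : ∑ i, AdjoinRoot.of (.X ^ p - .C c : B[X]) (b i) * AdjoinRoot.root _ ^ (i : ℕ) = 0) (i : Fin p) :
    b i = 0 := by
  have hp : p ≠ 0 := fun h => by subst h; exact i.elim0
  rcases subsingleton_or_nontrivial B with h' | h'
  · exact Subsingleton.elim _ _
  have hm : (.X ^ p - .C c : B[X]).Monic := Polynomial.monic_X_pow_sub_C c hp
  set g : B[X] := ∑ i : Fin p, .C (b i) * .X ^ (i : ℕ) with hg
  have h0 : AdjoinRoot.mk (.X ^ p - .C c : B[X]) g = 0 := by
    rw [hg, _root_.map_sum, ← h]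
    refine Finset.sum_congr rfl fun i _ => ?_
    rw [_root_.map_mul, AdjoinRoot.mk_C, _root_.map_pow, AdjoinRoot.mk_X]
  have hg0 : g = 0 := by
    by_contra hne
    refine hm.not_dvd_of_degree_lt hne ?_ (AdjoinRoot.mk_eq_zero.mp h0)
    rw [Polynomial.degree_X_pow_sub_C (Nat.pos_of_ne_zero hp), hg]
    refine (Polynomial.degree_sum_fin_lt b)
  have := congrArg (fun g => Polynomial.coeff g i) hg0
  simpa [hg, Polynomial.finsetSum_coeff, Polynomial.coeff_C_mul_X_pow, Fin.val_inj] using this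

end XPowSubC

/-! ### The ideal `(p, q - 1)` and lifts of Frobenius. -/

section Ideals

variable (p : ℕ) {R : Type*} [CommRing R] (q : R)

theorem map_span_pow_eq_qIdeal_pow (B : Type*) [CommRing B] [Algebra R B] (n : ℕ) :
    ((Ideal.span {(p : R), q - 1}) ^ n).map (algebraMap R B) = qIdeal p q B ^ n := by
  rw [Ideal.map_pow, Ideal.map_span, qIdeal, Set.image_pair, map_natCast]

theorem map_C_map_aeval_eq_qIdeal_pow {B : Type*} [CommRing B] [Algebra R B] (x : B) (n : ℕ) :
    (((Ideal.span {(p : R), q - 1}) ^ n).map (Polynomial.C : R →+* R[X])).map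
      (Polynomial.aeval (R := R) x).toRingHom = qIdeal p q B ^ n := by
  rw [Ideal.map_map, ← map_span_pow_eq_qIdeal_pow]
  congr 1
  ext r
  simp

end Ideals

section Frobenius

variable {p : ℕ} [Fact p.Prime] {R : Type*} [CommRing R] {δR : DeltaStructure p R} {q : R}
  {A : Type*} [CommRing A] [Algebra R A] {δA : DeltaStructure p A}

theorem DeltaStructure.frobenius_apply (r : R) : δR.frobenius r = r ^ p + (p : R) * δR.δ r := rfl

theorem DeltaStructure.frobenius_of_delta_eq_zero {r : R} (h : δR.δ r = 0) :
    δR.frobenius r = r ^ p := by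
  rw [frobenius_apply, h, mul_zero, add_zero]

theorem DeltaStructure.frobenius_algebraMap
    (hδ : ∀ r : R, δA.δ (algebraMap R A r) = algebraMap R A (δR.δ r)) (r : R) :
    δA.frobenius (algebraMap R A r) = algebraMap R A (δR.frobenius r) := by
  rw [frobenius_apply, frobenius_apply, hδ]
  simp

theorem DeltaStructure.frobenius_mem_span (hq : δR.δ q = 0) {r : R}
    (hr : r ∈ Ideal.span {(p : R), q - 1}) : δR.frobenius r ∈ Ideal.span {(p : R), q - 1} := by
  have : Ideal.span {(p : R), q - 1} ≤ (Ideal.span {(p : R), q - 1}).comap δR.frobenius := by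
    rw [Ideal.span_le]
    rintro _ (rfl | rfl)
    · rw [SetLike.mem_coe, Ideal.mem_comap, map_natCast]
      exact Ideal.subset_span (Set.mem_insert _ _)
    · rw [SetLike.mem_coe, Ideal.mem_comap, _root_.map_sub, _root_.map_one, frobenius_of_delta_eq_zero hq]
      exact Ideal.mem_of_dvd _ (sub_one_dvd_pow_sub_one q p) (Ideal.subset_span (Set.mem_insert_of_mem _ rfl))
  exact this hr

theorem DeltaStructure.frobenius_mem_span_pow (hq : δR.δ q = 0) {r : R} {n : ℕ}
    (hr : r ∈ Ideal.span {(p : R), q - 1} ^ n) :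
    δR.frobenius r ∈ Ideal.span {(p : R), q - 1} ^ n := by
  have : Ideal.span {(p : R), q - 1} ≤ (Ideal.span {(p : R), q - 1}).comap δR.frobenius :=
    fun r hr => frobenius_mem_span hq hr
  have h2 := (Ideal.pow_right_mono this n).trans (Ideal.le_comap_pow _ n)
  exact h2 hr

/-- The lift of Frobenius on `R[X]` which sends `X` to `X ^ p`. -/
noncomputable def polynomialFrobenius (δR : DeltaStructure p R) : R[X] →+* R[X] :=
  Polynomial.eval₂RingHom (Polynomial.C.comp δR.frobenius) (.X ^ p)

theorem aeval_polynomialFrobenius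
    (hδ : ∀ r : R, δA.δ (algebraMap R A r) = algebraMap R A (δR.δ r)) {x : A} (hx : δA.δ x = 0)
    (t : R[X]) :
    Polynomial.aeval x (polynomialFrobenius δR t) = δA.frobenius (Polynomial.aeval x t) := by
  have : (Polynomial.aeval (R := R) x).toRingHom.comp (polynomialFrobenius δR) =
      δA.frobenius.comp (Polynomial.aeval (R := R) x).toRingHom := by
    refine Polynomial.ringHom_ext (fun r => ?_) ?_
    · simp [polynomialFrobenius, DeltaStructure.frobenius_algebraMap hδ]
    · simp [polynomialFrobenius, DeltaStructure.frobenius_of_delta_eq_zero hx]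
  exact RingHom.congr_fun this t

end Frobenius

/-! ### The uncompleted pullback: generators and finiteness. -/

section RelativeFrobenius

variable {p : ℕ} [Fact p.Prime] {R : Type u} [CommRing R] {δR : DeltaStructure p R} {q : R}
  {A : Type u} [CommRing A] [Algebra R A]

theorem UncompletedPullback.one_tmul_algebraMap (r : R) :
    ((1 : AlgebraVia δR.frobenius) ⊗ₜ[R] algebraMap R A r : UncompletedPullback δR A) =
      UncompletedPullback.scalar δR A (δR.frobenius r) := by
  rw [Algebra.algebraMap_eq_smul_one, TensorProduct.tmul_smul, TensorProduct.smul_tmul',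
    Algebra.smul_def, mul_one]
  rfl

theorem UncompletedPullback.tmul_eq (r : R) (a : A) :
    (AlgebraVia.of δR.frobenius r ⊗ₜ[R] a : UncompletedPullback δR A) =
      UncompletedPullback.scalar δR A r * (1 : AlgebraVia δR.frobenius) ⊗ₜ[R] a := by
  change _ = (AlgebraVia.of δR.frobenius r ⊗ₜ[R] (1 : A) : UncompletedPullback δR A) * _
  rw [Algebra.TensorProduct.tmul_mul_tmul, mul_one, one_mul]

/-- A ring homomorphism on `R ⊗_{φ, R} A` is determined by its restrictions to both factors. -/
theorem UncompletedPullback.ringHom_ext {B : Type*} [CommRing B]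
    {f g : UncompletedPullback δR A →+* B}
    (h₁ : ∀ r, f (UncompletedPullback.scalar δR A r) = g (UncompletedPullback.scalar δR A r))
    (h₂ : ∀ a : A, f ((1 : AlgebraVia δR.frobenius) ⊗ₜ[R] a) =
      g ((1 : AlgebraVia δR.frobenius) ⊗ₜ[R] a)) : f = g := by
  refine RingHom.ext fun z => ?_
  induction z using TensorProduct.induction_on with
  | zero => rw [_root_.map_zero, _root_.map_zero]
  | add y z hy hz => rw [_root_.map_add, _root_.map_add, hy, hz]
  | tmul r a =>
    have := UncompletedPullback.tmul_eq (δR := δR) (AlgebraVia.val δR.frobenius r) a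
    change r ⊗ₜ[R] a = _ at this
    rw [this, _root_.map_mul, _root_.map_mul, h₁, h₂]

theorem UncompletedPullback.ideal_pow (n : ℕ) : UncompletedPullback.ideal δR q A ^ n =
    ((Ideal.span {(p : R), q - 1}) ^ n).map (UncompletedPullback.scalar δR A) := by
  rw [Ideal.map_pow, Ideal.map_span, UncompletedPullback.ideal, Set.image_pair, map_natCast]

/-- The map `a ↦ 1 ⊗ a` is only `φ`-semilinear over `R`; it is continuous because `φ` preserves `(p,
q - 1)`, as `q - 1` divides `φ (q - 1) = q ^ p - 1`. -/
theorem UncompletedPullback.one_tmul_mem (hq : δR.δ q = 0) {n : ℕ} {a : A}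
    (ha : a ∈ qIdeal p q A ^ n) :
    ((1 : AlgebraVia δR.frobenius) ⊗ₜ[R] a : UncompletedPullback δR A) ∈
      UncompletedPullback.ideal δR q A ^ n := by
  have : qIdeal p q A ^ n ≤ (UncompletedPullback.ideal δR q A ^ n).comap
      (Algebra.TensorProduct.includeRight : A →ₐ[R] AlgebraVia δR.frobenius ⊗[R] A).toRingHom := by
    rw [← map_span_pow_eq_qIdeal_pow, Ideal.map_le_iff_le_comap]
    intro r hr
    change (1 : AlgebraVia δR.frobenius) ⊗ₜ[R] algebraMap R A r ∈ UncompletedPullback.ideal δR q A ^ n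
    rw [UncompletedPullback.one_tmul_algebraMap, UncompletedPullback.ideal_pow]
    exact Ideal.mem_map_of_mem _ (DeltaStructure.frobenius_mem_span_pow hq hr)
  exact this ha

omit [Fact p.Prime] in
theorem finitePresentation_quotient_of_isTopEtaleCoordinate {x : A}
    (hx : IsTopEtaleCoordinate (Ideal.span {(p : R), q - 1}) x) (n : ℕ) :
    (algebraMap R (A ⧸ qIdeal p q A ^ n)).FinitePresentation := by
  have h := hx n
  rw [← map_C_map_aeval_eq_qIdeal_pow p q x n]
  set L := ((Ideal.span {(p : R), q - 1}) ^ n).map (Polynomial.C : R →+* R[X])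
  set f := (Polynomial.aeval (R := R) x).toRingHom
  have h1 : (Ideal.quotientMap (L.map f) f Ideal.le_comap_map).FinitePresentation := by
    let _ := (Ideal.quotientMap (L.map f) f Ideal.le_comap_map).toAlgebra
    have : Algebra.Etale (R[X] ⧸ L) (A ⧸ L.map f) := h
    exact this.finitePresentation
  have h2 : (Ideal.Quotient.mk L).FinitePresentation := by
    refine RingHom.FinitePresentation.of_surjective _ Ideal.Quotient.mk_surjective ?_
    rw [Ideal.mk_ker]
    refine Ideal.FG.map (Ideal.FG.pow ?_) _
    exact Submodule.fg_span (Set.toFinite _)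
  have h3 : (Polynomial.C : R →+* R[X]).FinitePresentation := by
    rw [← Polynomial.algebraMap_eq, RingHom.finitePresentation_algebraMap]
    infer_instance
  convert h1.comp (h2.comp h3) using 1
  ext r
  change _ = Ideal.Quotient.mk _ (Polynomial.aeval x (Polynomial.C r))
  rw [Polynomial.aeval_C]
  rfl

/-- The quotient receives a surjection from the base change along `φ` of the finite type algebra `A
/ (p, q - 1) ^ n`. -/
theorem UncompletedPullback.finiteType_quotient (hq : δR.δ q = 0) {n : ℕ}
    (h : (algebraMap R (A ⧸ qIdeal p q A ^ n)).FiniteType) :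
    ((Ideal.Quotient.mk (UncompletedPullback.ideal δR q A ^ n)).comp
      (UncompletedPullback.scalar δR A)).FiniteType := by
  have : Algebra.FiniteType R (A ⧸ qIdeal p q A ^ n) := by
    rwa [RingHom.finiteType_algebraMap] at h
  let Q := UncompletedPullback δR A ⧸ UncompletedPullback.ideal δR q A ^ n
  let i : A →ₐ[R] Q := (Ideal.Quotient.mkₐ R (UncompletedPullback.ideal δR q A ^ n)).comp
      Algebra.TensorProduct.includeRight
  let j : (A ⧸ qIdeal p q A ^ n) →ₐ[R] Q := Ideal.Quotient.liftₐ _ i fun a ha =>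
    Ideal.Quotient.eq_zero_iff_mem.mpr (UncompletedPullback.one_tmul_mem hq ha)
  let l : AlgebraVia δR.frobenius ⊗[R] (A ⧸ qIdeal p q A ^ n) →ₐ[AlgebraVia δR.frobenius] Q :=
    Algebra.TensorProduct.lift (Algebra.ofId _ _) j fun _ _ => Commute.all _ _
  have hl : Function.Surjective l := by
    have hc : l.toRingHom.comp (Algebra.TensorProduct.map (.id R (AlgebraVia δR.frobenius))
        (Ideal.Quotient.mkₐ R (qIdeal p q A ^ n))).toRingHom = Ideal.Quotient.mk _ := by
      refine UncompletedPullback.ringHom_ext (fun r => ?_) (fun a => ?_)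
      · change l (AlgebraVia.of δR.frobenius r ⊗ₜ[R] Ideal.Quotient.mk _ 1) = _
        rw [_root_.map_one]
        exact (Algebra.TensorProduct.lift_tmul _ _ _ _ _).trans (by rw [_root_.map_one, mul_one]; rfl)
      · change l ((1 : AlgebraVia δR.frobenius) ⊗ₜ[R] Ideal.Quotient.mk _ a) = _
        exact (Algebra.TensorProduct.lift_tmul _ _ _ _ _).trans (by rw [_root_.map_one, one_mul]; rfl)
    intro z
    obtain ⟨z, rfl⟩ := Ideal.Quotient.mk_surjective z
    exact ⟨_, RingHom.congr_fun hc z⟩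
  have h1 : (algebraMap (AlgebraVia δR.frobenius) Q).FiniteType :=
    RingHom.finiteType_algebraMap.mpr (Algebra.FiniteType.of_surjective l hl)
  have h2 : (AlgebraVia.of δR.frobenius).FiniteType :=
    RingHom.FiniteType.of_surjective _ Function.surjective_id
  exact h1.comp h2

end RelativeFrobenius

/-- Raising to the power `p` is additive modulo `N`, since `p ∈ N`. -/
theorem sum_mul_pow_pow_sub_mem {p : ℕ} [Fact p.Prime] {A B ι : Type*} [CommRing A] [CommRing B]
    [Fintype ι] (N : Ideal B) (hp : (p : B) ∈ N) (ψ : A →+* B) (u : ι → B) (T : B) (c : ι → A)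
    (x : A) (hu : ∀ i, u i ^ p - ψ (c i) ∈ N) (hT : T ^ p - ψ x ∈ N) {k : ι → ℕ} :
    (∑ i, u i * T ^ k i) ^ p - ψ (∑ i, c i * x ^ k i) ∈ N := by
  have hp' : (p : B ⧸ N) = 0 := by
    rw [← map_natCast (Ideal.Quotient.mk N)]
    exact Ideal.Quotient.eq_zero_iff_mem.mpr hp
  have hu' : ∀ i, powPrimeHom hp' (Ideal.Quotient.mk N (u i)) = Ideal.Quotient.mk N (ψ (c i)) :=
    fun i => (Ideal.Quotient.mk_eq_mk_iff_sub_mem _ _).mpr (hu i)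
  have hT' : powPrimeHom hp' (Ideal.Quotient.mk N T) = Ideal.Quotient.mk N (ψ x) :=
    (Ideal.Quotient.mk_eq_mk_iff_sub_mem _ _).mpr hT
  rw [← Ideal.Quotient.mk_eq_mk_iff_sub_mem]
  change powPrimeHom hp' (Ideal.Quotient.mk N _) = _
  simp only [_root_.map_sum, _root_.map_mul, hu']
  simp only [_root_.map_pow, hT']

/-! ### `A` is free over `A'` modulo each power of `(p, q - 1)`. -/

section RelativeFrobenius

variable {p : ℕ} [Fact p.Prime] {R : Type u} [CommRing R] (δR : DeltaStructure p R) (q : R)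
  {A : Type u} [CommRing A] [Algebra R A]

/-- The ring `A'[T] / (T ^ p - x')` modulo the `n`-th power of `(p, q - 1)`, which is a model of
`A` modulo this power. -/
abbrev PullbackRoot (n : ℕ) (x : A) : Type u :=
  AdjoinRoot (.X ^ p - .C (Ideal.Quotient.mk (UncompletedPullback.ideal δR q A ^ n)
    ((1 : AlgebraVia δR.frobenius) ⊗ₜ[R] x)) :
      (UncompletedPullback δR A ⧸ UncompletedPullback.ideal δR q A ^ n)[X])

/-- The canonical map from `R ⊗_{φ, R} A`. -/
noncomputable def PullbackRoot.of (n : ℕ) (x : A) :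
    UncompletedPullback δR A →+* PullbackRoot δR q n x :=
  (AdjoinRoot.of _).comp (Ideal.Quotient.mk _)

variable {δR q}

theorem PullbackRoot.root_pow (n : ℕ) (x : A) :
    (AdjoinRoot.root _ : PullbackRoot δR q n x) ^ p =
      PullbackRoot.of δR q n x ((1 : AlgebraVia δR.frobenius) ⊗ₜ[R] x) := by
  have := AdjoinRoot.mk_self (f := (.X ^ p - .C (Ideal.Quotient.mk
    (UncompletedPullback.ideal δR q A ^ n) ((1 : AlgebraVia δR.frobenius) ⊗ₜ[R] x)) :
      (UncompletedPullback δR A ⧸ UncompletedPullback.ideal δR q A ^ n)[X]))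
  rw [_root_.map_sub, _root_.map_pow, AdjoinRoot.mk_X, AdjoinRoot.mk_C, sub_eq_zero] at this
  exact this

theorem PullbackRoot.of_eq_zero (n : ℕ) (x : A) {b : UncompletedPullback δR A}
    (hb : b ∈ UncompletedPullback.ideal δR q A ^ n) : PullbackRoot.of δR q n x b = 0 := by
  rw [PullbackRoot.of, RingHom.comp_apply, Ideal.Quotient.eq_zero_iff_mem.mpr hb, _root_.map_zero]

theorem PullbackRoot.exists_eq_sum (n : ℕ) (x : A) (z : PullbackRoot δR q n x) :
    ∃ b : Fin p → UncompletedPullback δR A,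
      z = ∑ i, PullbackRoot.of δR q n x (b i) * AdjoinRoot.root _ ^ (i : ℕ) := by
  obtain ⟨b, hb⟩ := AdjoinRoot.exists_eq_sum_X_pow_sub_C _ (Fact.out : p.Prime).ne_zero z
  choose c hc using fun i => Ideal.Quotient.mk_surjective (b i)
  refine ⟨c, hb.trans (Finset.sum_congr rfl fun i _ => ?_)⟩
  rw [PullbackRoot.of, RingHom.comp_apply, hc]

theorem PullbackRoot.mem_of_sum_eq_zero (n : ℕ) (x : A) (b : Fin p → UncompletedPullback δR A)
    (h : ∑ i, PullbackRoot.of δR q n x (b i) * AdjoinRoot.root _ ^ (i : ℕ) = 0) (i : Fin p) :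
    b i ∈ UncompletedPullback.ideal δR q A ^ n :=
  Ideal.Quotient.eq_zero_iff_mem.mp
    (AdjoinRoot.eq_zero_of_sum_X_pow_sub_C _ (fun i => Ideal.Quotient.mk _ (b i)) h i)

variable {δA : DeltaStructure p A} (hδ : ∀ r : R, δA.δ (algebraMap R A r) = algebraMap R A (δR.δ r))

theorem uncompletedFrobenius_one_tmul (a : A) :
    uncompletedFrobenius δR δA hδ ((1 : AlgebraVia δR.frobenius) ⊗ₜ[R] a) = δA.frobenius a := by
  have := uncompletedFrobenius_tmul δR δA hδ 1 a
  rwa [_root_.map_one, _root_.map_one, one_mul] at this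

/-- The map to `A` modulo `(p, q - 1)`, given by the relative Frobenius and `T ↦ x`. -/
noncomputable def PullbackRoot.toQuotient (n : ℕ) {x : A} (hx : δA.δ x = 0) :
    PullbackRoot δR q (n + 1) x →+* A ⧸ qIdeal p q A :=
  AdjoinRoot.lift (Ideal.quotientMap (qIdeal p q A) (uncompletedFrobenius δR δA hδ)
      ((Ideal.pow_le_self n.succ_ne_zero).trans
        (Ideal.map_le_iff_le_comap.mp (map_ideal_le δR q δA hδ))))
    (Ideal.Quotient.mk _ x) (by
      rw [Polynomial.eval₂_sub, Polynomial.eval₂_pow, Polynomial.eval₂_X, Polynomial.eval₂_C,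
        Ideal.quotientMap_mk, uncompletedFrobenius_one_tmul,
        DeltaStructure.frobenius_of_delta_eq_zero hx, _root_.map_pow, sub_self])

theorem PullbackRoot.toQuotient_of (n : ℕ) {x : A} (hx : δA.δ x = 0)
    (b : UncompletedPullback δR A) :
    PullbackRoot.toQuotient (q := q) hδ n hx (PullbackRoot.of δR q (n + 1) x b) =
      Ideal.Quotient.mk _ (uncompletedFrobenius δR δA hδ b) :=
  (AdjoinRoot.lift_of _).trans rfl

theorem PullbackRoot.toQuotient_root (n : ℕ) {x : A} (hx : δA.δ x = 0) :
    PullbackRoot.toQuotient (q := q) hδ n hx (AdjoinRoot.root _) = Ideal.Quotient.mk _ x :=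
  AdjoinRoot.lift_root _

/-- The image contains the image of `R[x]`, and also all `p`-th powers because `φ a ≡ a ^ p` modulo
`p`. Since `A / (p, q - 1)` is unramified over `R[x]`, such a subring is everything. -/
theorem PullbackRoot.toQuotient_surjective (n : ℕ) {x : A}
    (hx : IsTopEtaleCoordinate (Ideal.span {(p : R), q - 1}) x) (hδx : δA.δ x = 0) :
    Function.Surjective (PullbackRoot.toQuotient (q := q) hδ n hδx) := by
  have h := hx 1
  let f := (Polynomial.aeval (R := R) x).toRingHom
  let L := ((Ideal.span {(p : R), q - 1}) ^ 1).map (Polynomial.C : R →+* R[X])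
  have hI : L.map f = qIdeal p q A := by
    rw [map_C_map_aeval_eq_qIdeal_pow, pow_one]
  have key : ∀ (K : Ideal A) (hK : L.map f = K) (A₀ : Subring (A ⧸ K)), (p : A ⧸ K) = 0 →
      (∀ t, Ideal.Quotient.mk K (f t) ∈ A₀) → (∀ a : A ⧸ K, a ^ p ∈ A₀) → A₀ = ⊤ := by
    rintro K rfl A₀ hp h1 h2
    have he : (Ideal.quotientMap (L.map f) f Ideal.le_comap_map).Etale := h
    refine Subring.eq_top_of_pow_mem_of_unramified hp _ he.formallyUnramified ?_ A₀ ?_ h2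
    · let _ := (Ideal.quotientMap (L.map f) f Ideal.le_comap_map).toAlgebra
      have : Algebra.Etale (R[X] ⧸ L) (A ⧸ L.map f) := h
      exact inferInstanceAs (Algebra.FiniteType (R[X] ⧸ L) (A ⧸ L.map f))
    · intro s
      obtain ⟨s, rfl⟩ := Ideal.Quotient.mk_surjective s
      exact h1 s
  have hp : (p : A ⧸ qIdeal p q A) = 0 := by
    rw [← map_natCast (Ideal.Quotient.mk (qIdeal p q A))]
    exact Ideal.Quotient.eq_zero_iff_mem.mpr (Ideal.subset_span (Set.mem_insert _ _))
  have := key _ hI (PullbackRoot.toQuotient (q := q) hδ n hδx).range hp (fun t => ?_) (fun a => ?_)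
  · exact RingHom.range_eq_top.mp this
  · induction t using Polynomial.induction_on' with
    | add s t hs ht =>
      rw [_root_.map_add, _root_.map_add]
      exact Subring.add_mem _ hs ht
    | monomial k r =>
      rw [← Polynomial.C_mul_X_pow_eq_monomial]
      refine ⟨PullbackRoot.of δR q (n + 1) x (UncompletedPullback.scalar δR A r) *
        AdjoinRoot.root _ ^ k, ?_⟩
      rw [_root_.map_mul, _root_.map_pow, toQuotient_of, toQuotient_root,
        uncompletedFrobenius_scalar]
      simp [f]
  · obtain ⟨a, rfl⟩ := Ideal.Quotient.mk_surjective a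
    refine ⟨PullbackRoot.of δR q (n + 1) x ((1 : AlgebraVia δR.frobenius) ⊗ₜ[R] a), ?_⟩
    rw [toQuotient_of, uncompletedFrobenius_one_tmul, DeltaStructure.frobenius_apply,
      _root_.map_add, _root_.map_mul, map_natCast, hp, zero_mul, add_zero, _root_.map_pow]

/-- The source is of finite type over `R` and the target is finitely presented. Finite generation is
what turns a nil kernel into a nilpotent one. -/
theorem PullbackRoot.ker_toQuotient_fg (hq : δR.δ q = 0) (n : ℕ) {x : A}
    (hx : IsTopEtaleCoordinate (Ideal.span {(p : R), q - 1}) x) (hδx : δA.δ x = 0) :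
    (RingHom.ker (PullbackRoot.toQuotient (q := q) hδ n hδx)).FG := by
  refine RingHom.FinitePresentation.ker_fg_of_comp
    ((PullbackRoot.of δR q (n + 1) x).comp (UncompletedPullback.scalar δR A)) ?_ _
    (PullbackRoot.toQuotient_surjective hδ n hx hδx) ?_
  · have h1 := UncompletedPullback.finiteType_quotient (δR := δR) (n := n + 1) hq
      (RingHom.FiniteType.of_finitePresentation
        (finitePresentation_quotient_of_isTopEtaleCoordinate hx _))
    have h2 : (AdjoinRoot.of (.X ^ p - .C (Ideal.Quotient.mk
        (UncompletedPullback.ideal δR q A ^ (n + 1)) ((1 : AlgebraVia δR.frobenius) ⊗ₜ[R] x)) :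
          (UncompletedPullback δR A ⧸ UncompletedPullback.ideal δR q A ^ (n + 1))[X])).FiniteType := by
      rw [← AdjoinRoot.algebraMap_eq, RingHom.finiteType_algebraMap]
      infer_instance
    exact h2.comp h1
  · have h1 := finitePresentation_quotient_of_isTopEtaleCoordinate hx 1
    rw [pow_one] at h1
    convert h1 using 1
    ext r
    change PullbackRoot.toQuotient (q := q) hδ n hδx (PullbackRoot.of δR q (n + 1) x _) = _
    rw [toQuotient_of, uncompletedFrobenius_scalar]
    rfl

/-- Modulo `p`, the composite of `F` with `a ↦ 1 ⊗ a` is the absolute Frobenius; this is checked on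
the two tensor factors, using `1 ⊗ r = φ r ⊗ 1` for scalars. -/
theorem UncompletedPullback.pow_sub_one_tmul_uncompletedFrobenius_mem
    (b : UncompletedPullback δR A) :
    b ^ p - (1 : AlgebraVia δR.frobenius) ⊗ₜ[R] uncompletedFrobenius δR δA hδ b ∈
      Ideal.span {(p : UncompletedPullback δR A)} := by
  have hp : (p : UncompletedPullback δR A ⧸ Ideal.span {(p : UncompletedPullback δR A)}) = 0 := by
    rw [← map_natCast (Ideal.Quotient.mk _)]
    exact Ideal.Quotient.eq_zero_iff_mem.mpr (Ideal.subset_span rfl)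
  have h : (powPrimeHom hp).comp (Ideal.Quotient.mk _) =
      (Ideal.Quotient.mk (Ideal.span {(p : UncompletedPullback δR A)})).comp
        ((Algebra.TensorProduct.includeRight :
          A →ₐ[R] AlgebraVia δR.frobenius ⊗[R] A).toRingHom.comp
            (uncompletedFrobenius δR δA hδ)) := by
    refine UncompletedPullback.ringHom_ext (fun r => ?_) (fun a => ?_)
    · change (Ideal.Quotient.mk _ (UncompletedPullback.scalar δR A r)) ^ p =
        Ideal.Quotient.mk _ ((1 : AlgebraVia δR.frobenius) ⊗ₜ[R]
          uncompletedFrobenius δR δA hδ (UncompletedPullback.scalar δR A r))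
      rw [uncompletedFrobenius_scalar, UncompletedPullback.one_tmul_algebraMap,
        DeltaStructure.frobenius_apply]
      simp [hp]
    · change (Ideal.Quotient.mk _ ((1 : AlgebraVia δR.frobenius) ⊗ₜ[R] a)) ^ p =
        Ideal.Quotient.mk _ ((1 : AlgebraVia δR.frobenius) ⊗ₜ[R]
          uncompletedFrobenius δR δA hδ ((1 : AlgebraVia δR.frobenius) ⊗ₜ[R] a))
      rw [uncompletedFrobenius_one_tmul, DeltaStructure.frobenius_apply, TensorProduct.tmul_add,
        ← nsmul_eq_mul, TensorProduct.tmul_smul, _root_.map_add, nsmul_eq_mul, _root_.map_mul,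
        map_natCast, hp, zero_mul, add_zero, ← _root_.map_pow, Algebra.TensorProduct.tmul_pow,
        one_pow]
  exact (Ideal.Quotient.mk_eq_mk_iff_sub_mem _ _).mp (RingHom.congr_fun h b)

/-- Let `z = ∑ b i T ^ i` be in the kernel. Modulo `p`, its `p`-th power is `1 ⊗ a` with `a = ∑ F (b
i) x ^ i`, and `a ∈ (p, q - 1)` says exactly that `z` maps to zero. So `z ^ p` lies in the nilpotent
ideal generated by `(p, q - 1)`. -/
theorem PullbackRoot.isNilpotent_ker_toQuotient (hq : δR.δ q = 0) (n : ℕ) {x : A}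
    (hx : IsTopEtaleCoordinate (Ideal.span {(p : R), q - 1}) x) (hδx : δA.δ x = 0) :
    IsNilpotent (RingHom.ker (PullbackRoot.toQuotient (q := q) hδ n hδx)) := by
  rw [Ideal.FG.isNilpotent_iff_le_nilradical (ker_toQuotient_fg hδ hq n hx hδx)]
  intro z hz
  obtain ⟨b, rfl⟩ := PullbackRoot.exists_eq_sum (n + 1) x z
  set z := ∑ i, PullbackRoot.of δR q (n + 1) x (b i) * AdjoinRoot.root _ ^ (i : ℕ) with hzdef
  let N : Ideal (PullbackRoot δR q (n + 1) x) :=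
    (UncompletedPullback.ideal δR q A).map (PullbackRoot.of δR q (n + 1) x)
  have hN : N ^ (n + 1) = ⊥ := by
    rw [← Ideal.map_pow, eq_bot_iff, Ideal.map_le_iff_le_comap]
    exact fun b hb => PullbackRoot.of_eq_zero (n + 1) x hb
  have hpI : (p : UncompletedPullback δR A) ∈ UncompletedPullback.ideal δR q A :=
    Ideal.subset_span (Set.mem_insert _ _)
  have hp : (p : PullbackRoot δR q (n + 1) x) ∈ N := by
    rw [← map_natCast (PullbackRoot.of δR q (n + 1) x)]
    exact Ideal.mem_map_of_mem _ hpI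
  let a : A := ∑ i, uncompletedFrobenius δR δA hδ (b i) * x ^ (i : ℕ)
  have ha : a ∈ qIdeal p q A := by
    rw [RingHom.mem_ker, hzdef, _root_.map_sum] at hz
    rw [← Ideal.Quotient.eq_zero_iff_mem, ← hz, _root_.map_sum]
    refine Finset.sum_congr rfl fun i _ => ?_
    rw [_root_.map_mul, _root_.map_mul, _root_.map_pow, _root_.map_pow, toQuotient_of,
      toQuotient_root]
  let ψ : A →+* PullbackRoot δR q (n + 1) x := (PullbackRoot.of δR q (n + 1) x).comp
    (Algebra.TensorProduct.includeRight : A →ₐ[R] AlgebraVia δR.frobenius ⊗[R] A).toRingHom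
  have hψa : ψ a ∈ N := Ideal.mem_map_of_mem _
    (by simpa using UncompletedPullback.one_tmul_mem (δR := δR) hq (n := 1) (by simpa using ha))
  have hzN : z ^ p - ψ a ∈ N := by
    refine sum_mul_pow_pow_sub_mem N hp ψ _ _ _ x
      (fun i => ?_) ?_
    · change _ - PullbackRoot.of δR q (n + 1) x _ ∈ _
      rw [← _root_.map_pow, ← _root_.map_sub]
      refine Ideal.mem_map_of_mem _ ?_
      exact (Ideal.span_singleton_le_iff_mem _).mpr hpI
        (UncompletedPullback.pow_sub_one_tmul_uncompletedFrobenius_mem hδ (b i))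
    · rw [PullbackRoot.root_pow]
      change ψ x - ψ x ∈ N
      rw [sub_self]
      exact N.zero_mem
  have : z ^ p ∈ N := by
    have := N.add_mem hzN hψa
    rwa [sub_add_cancel] at this
  refine ⟨p * (n + 1), ?_⟩
  rw [pow_mul]
  have := Ideal.pow_mem_pow this (n + 1)
  rwa [hN] at this

/-- The relative Frobenius has a section `A → A'[T] / (T ^ p - x')` modulo each power of
`(p, q - 1)`. -/
theorem PullbackRoot.exists_section (hq : δR.δ q = 0) (n : ℕ) {x : A}
    (hx : IsTopEtaleCoordinate (Ideal.span {(p : R), q - 1}) x) (hδx : δA.δ x = 0) :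
    ∃ s : A →+* PullbackRoot δR q (n + 1) x, s x = AdjoinRoot.root _ ∧
      (∀ b, s (uncompletedFrobenius δR δA hδ b) = PullbackRoot.of δR q (n + 1) x b) ∧
      ∀ a ∈ qIdeal p q A ^ (n + 1), s a = 0 := by
  let f := (Polynomial.aeval (R := R) x).toRingHom
  let π := PullbackRoot.toQuotient (q := q) hδ n hδx
  have hπ : Function.Surjective π := PullbackRoot.toQuotient_surjective hδ n hx hδx
  let g : R[X] →+* PullbackRoot δR q (n + 1) x := Polynomial.eval₂RingHom
    ((PullbackRoot.of δR q (n + 1) x).comp (UncompletedPullback.scalar δR A)) (AdjoinRoot.root _)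
  have hgC : ∀ r, g (.C r) =
      PullbackRoot.of δR q (n + 1) x (UncompletedPullback.scalar δR A r) := fun r => by
    simp [g]
  have hgX : g .X = AdjoinRoot.root _ := by simp [g]
  have hπg : π.comp g = (Ideal.Quotient.mk (qIdeal p q A)).comp f := by
    refine Polynomial.ringHom_ext (fun r => ?_) ?_
    · rw [RingHom.comp_apply, hgC, RingHom.comp_apply, toQuotient_of, uncompletedFrobenius_scalar]
      simp [f]
    · rw [RingHom.comp_apply, hgX, RingHom.comp_apply, toQuotient_root]
      simp [f]
  have hg : ∀ t ∈ ((Ideal.span {(p : R), q - 1}) ^ (n + 1)).map (Polynomial.C : R →+* R[X]),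
      g t = 0 := by
    have : ((Ideal.span {(p : R), q - 1}) ^ (n + 1)).map (Polynomial.C : R →+* R[X]) ≤
        RingHom.ker g := by
      rw [Ideal.map_le_iff_le_comap]
      intro r hr
      rw [Ideal.mem_comap, RingHom.mem_ker, hgC]
      refine PullbackRoot.of_eq_zero _ _ ?_
      rw [UncompletedPullback.ideal_pow]
      exact Ideal.mem_map_of_mem _ hr
    exact this
  have hnil := isNilpotent_ker_toQuotient hδ hq n hx hδx
  let e := RingHom.quotientKerEquivOfSurjective hπ
  -- The nilpotent thickening is `π`; the map to lift is the reduction `A → A / (p, q - 1)`,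
  -- compatible on `R[X]` with `X ↦ T`.
  obtain ⟨s, hs, hs'⟩ := exists_ringHom_lift_of_etale_quotient f _ (hx (n + 1)) (RingHom.ker π)
    hnil g hg ((e.symm : _ →+* _).comp (Ideal.Quotient.mk (qIdeal p q A))) (fun t => by
      change e.symm _ = _
      rw [RingEquiv.symm_apply_eq]
      exact (RingHom.congr_fun hπg t).symm)
  have hπs : ∀ a, π (s a) = Ideal.Quotient.mk _ a := fun a => by
    have := hs' a
    change _ = e.symm _ at this
    rw [RingEquiv.eq_symm_apply] at this
    exact this
  have hsR : ∀ r, s (algebraMap R A r) =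
      PullbackRoot.of δR q (n + 1) x (UncompletedPullback.scalar δR A r) := fun r => by
    rw [← hgC, ← hs]
    simp [f]
  have hsx : s x = AdjoinRoot.root _ := by
    rw [← hgX, ← hs]
    simp [f]
  let ψ : A →+* PullbackRoot δR q (n + 1) x := (PullbackRoot.of δR q (n + 1) x).comp
    (Algebra.TensorProduct.includeRight : A →ₐ[R] AlgebraVia δR.frobenius ⊗[R] A).toRingHom
  have hψ : ∀ a, ψ a = PullbackRoot.of δR q (n + 1) x ((1 : AlgebraVia δR.frobenius) ⊗ₜ[R] a) :=
    fun _ => rfl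
  -- `s ∘ φ` and `a ↦ 1 ⊗ a` agree modulo the kernel of `π`, and on `R[X]`, where both send `X` to
  -- `T ^ p = x'`. By rigidity their difference lies in every power of that nilpotent kernel.
  have hψs : ∀ a, s (δA.frobenius a) = ψ a := by
    obtain ⟨k, hk⟩ := hnil
    let E : A →+ PullbackRoot δR q (n + 1) x :=
      (s.comp δA.frobenius).toAddMonoidHom - ψ.toAddMonoidHom
    have hE : ∀ a, E a = s (δA.frobenius a) - ψ a := fun _ => rfl
    have hπψ : ∀ a, π (ψ a) = Ideal.Quotient.mk _ (δA.frobenius a) := fun a => by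
      rw [hψ, toQuotient_of, uncompletedFrobenius_one_tmul]
    have := mem_pow_of_twisted_derivation f _ (hx 1).formallyUnramified (RingHom.ker π)
      ψ (s.comp δA.frobenius) (fun a => ?_) (fun t ht => ?_) E (fun a b => ?_) ?_ k
    · intro a
      have h := this a
      rw [hk, Ideal.zero_eq_bot, Ideal.mem_bot, hE, sub_eq_zero] at h
      exact h
    · rw [RingHom.mem_ker, _root_.map_sub, hπψ, RingHom.comp_apply, hπs, sub_self]
    · rw [RingHom.mem_ker, hπψ, Ideal.Quotient.eq_zero_iff_mem]
      have h1 : f t ∈ qIdeal p q A := by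
        have := Ideal.mem_map_of_mem f ht
        rwa [map_C_map_aeval_eq_qIdeal_pow, pow_one] at this
      rw [DeltaStructure.frobenius_apply]
      exact Ideal.add_mem _ (Ideal.pow_mem_of_mem _ h1 _ (Fact.out : p.Prime).pos)
        (Ideal.mul_mem_right _ _ (Ideal.subset_span (Set.mem_insert _ _)))
    · change s (δA.frobenius (a * b)) - ψ (a * b) = (s (δA.frobenius a) - ψ a) * ψ b +
        s (δA.frobenius a) * (s (δA.frobenius b) - ψ b)
      rw [_root_.map_mul δA.frobenius, _root_.map_mul s, _root_.map_mul ψ]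
      ring
    · intro t
      rw [hE, sub_eq_zero]
      have h1 : δA.frobenius (f t) = f (polynomialFrobenius δR t) :=
        (aeval_polynomialFrobenius hδ hδx t).symm
      rw [h1, hs]
      have h2 : g.comp (polynomialFrobenius δR) = ψ.comp f := by
        refine Polynomial.ringHom_ext (fun r => ?_) ?_
        · rw [RingHom.comp_apply, RingHom.comp_apply, hψ]
          have h3 : f (.C r) = algebraMap R A r := by simp [f]
          have h4 : polynomialFrobenius δR (.C r) = .C (δR.frobenius r) := by
            simp [polynomialFrobenius]
          rw [h3, h4, UncompletedPullback.one_tmul_algebraMap, hgC]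
        · rw [RingHom.comp_apply, RingHom.comp_apply, hψ]
          have h3 : f .X = x := by simp [f]
          have h4 : polynomialFrobenius δR .X = .X ^ p := by
            simp [polynomialFrobenius]
          rw [h3, h4, _root_.map_pow, hgX, PullbackRoot.root_pow]
      exact RingHom.congr_fun h2 t
  refine ⟨s, hsx, fun b => ?_, fun a ha => ?_⟩
  · refine RingHom.congr_fun (f := s.comp (uncompletedFrobenius δR δA hδ))
      (UncompletedPullback.ringHom_ext (fun r => ?_) (fun a => ?_)) b
    · rw [RingHom.comp_apply, uncompletedFrobenius_scalar, hsR]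
    · rw [RingHom.comp_apply, uncompletedFrobenius_one_tmul, hψs]
      rfl
  · have : qIdeal p q A ^ (n + 1) ≤ RingHom.ker s := by
      rw [← map_C_map_aeval_eq_qIdeal_pow p q x, Ideal.map_le_iff_le_comap]
      intro t ht
      rw [Ideal.mem_comap, RingHom.mem_ker]
      exact (hs t).trans (hg t ht)
    exact this ha

/-- Independence of `1, …, x ^ (p - 1)` modulo `(p, q - 1) ^ n`: the section carries the relation to
one between `1, …, T ^ (p - 1)`, which are independent. -/
theorem mem_pow_of_sum_uncompletedFrobenius_mem (hq : δR.δ q = 0) (n : ℕ) {x : A}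
    (hx : IsTopEtaleCoordinate (Ideal.span {(p : R), q - 1}) x) (hδx : δA.δ x = 0)
    (b : Fin p → UncompletedPullback δR A)
    (h : ∑ i, uncompletedFrobenius δR δA hδ (b i) * x ^ (i : ℕ) ∈ qIdeal p q A ^ n)
    (i : Fin p) : b i ∈ UncompletedPullback.ideal δR q A ^ n := by
  rcases n with _ | n
  · simp
  obtain ⟨s, hsx, hsF, hs0⟩ := PullbackRoot.exists_section (q := q) hδ hq n hx hδx
  refine PullbackRoot.mem_of_sum_eq_zero (n + 1) x b ?_ i
  rw [← hs0 _ h, _root_.map_sum]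
  refine Finset.sum_congr rfl fun i _ => ?_
  rw [_root_.map_mul, _root_.map_pow, hsx, hsF]

/-- Spanning, by successive approximation. The first level is surjectivity of
`PullbackRoot.toQuotient`; an error in the `n`-th power is a combination of elements of `I ^ n ⊆ R`,
which can be moved into the coefficients because `F` is `R`-linear. -/
theorem exists_sub_sum_uncompletedFrobenius_mem {x : A}
    (hx : IsTopEtaleCoordinate (Ideal.span {(p : R), q - 1}) x) (hδx : δA.δ x = 0) (n : ℕ) (a : A) :
    ∃ b : Fin p → UncompletedPullback δR A,
      a - ∑ i, uncompletedFrobenius δR δA hδ (b i) * x ^ (i : ℕ) ∈ qIdeal p q A ^ n := by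
  have h1 : ∀ a : A, ∃ b : Fin p → UncompletedPullback δR A,
      a - ∑ i, uncompletedFrobenius δR δA hδ (b i) * x ^ (i : ℕ) ∈ qIdeal p q A := fun a => by
    obtain ⟨z, hz⟩ := PullbackRoot.toQuotient_surjective (q := q) hδ 0 hx hδx
      (Ideal.Quotient.mk _ a)
    obtain ⟨b, rfl⟩ := PullbackRoot.exists_eq_sum _ x z
    refine ⟨b, ?_⟩
    rw [← Ideal.Quotient.mk_eq_mk_iff_sub_mem, ← hz, _root_.map_sum, _root_.map_sum]
    refine Finset.sum_congr rfl fun i _ => ?_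
    rw [_root_.map_mul, _root_.map_mul, _root_.map_pow, _root_.map_pow,
      PullbackRoot.toQuotient_of, PullbackRoot.toQuotient_root]
  induction n generalizing a with
  | zero => exact ⟨0, by simp⟩
  | succ n ih =>
    obtain ⟨b, hb⟩ := ih a
    -- The free multiplier `a` makes the statement stable under multiplication by ring elements in
    -- the span induction.
    have h2 : ∀ y ∈ qIdeal p q A ^ n, ∀ a : A, ∃ c : Fin p → UncompletedPullback δR A,
        a * y - ∑ i, uncompletedFrobenius δR δA hδ (c i) * x ^ (i : ℕ) ∈
          qIdeal p q A ^ (n + 1) := by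
      intro y hy
      rw [← map_span_pow_eq_qIdeal_pow] at hy
      induction hy using Submodule.span_induction with
      | zero => exact fun _ => ⟨0, by simp⟩
      | add y z _ _ hy hz =>
        intro a
        obtain ⟨c, hc⟩ := hy a
        obtain ⟨d, hd⟩ := hz a
        refine ⟨c + d, ?_⟩
        convert Ideal.add_mem _ hc hd using 1
        simp only [Pi.add_apply, _root_.map_add, add_mul, Finset.sum_add_distrib]
        ring
      | mem y hy =>
        obtain ⟨r, hr, rfl⟩ := hy
        intro a
        obtain ⟨c, hc⟩ := h1 a
        refine ⟨fun i => UncompletedPullback.scalar δR A r * c i, ?_⟩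
        have hr' := Ideal.mem_map_of_mem (algebraMap R A) hr
        rw [map_span_pow_eq_qIdeal_pow] at hr'
        rw [pow_succ]
        convert Ideal.mul_mem_mul hr' hc using 1
        simp only [_root_.map_mul, uncompletedFrobenius_scalar, mul_sub, Finset.mul_sum, mul_assoc]
        rw [mul_comm a]
      | smul a y hy h =>
        intro a'
        rw [smul_eq_mul, ← mul_assoc]
        exact h _
    obtain ⟨c, hc⟩ := h2 _ hb 1
    rw [one_mul] at hc
    refine ⟨b + c, ?_⟩
    convert hc using 1
    simp only [Pi.add_apply, _root_.map_add, add_mul, Finset.sum_add_distrib]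
    ring

end RelativeFrobenius

/-- The ideal is generated by elements of `R`, so every `R`-linear map is continuous. -/
theorem LinearMap.map_mem_qIdeal_pow (p : ℕ) {R : Type*} [CommRing R] (q : R) {B C : Type*}
    [CommRing B] [CommRing C] [Algebra R B] [Algebra R C] (E : B →ₗ[R] C) {n : ℕ} {b : B}
    (hb : b ∈ qIdeal p q B ^ n) : E b ∈ qIdeal p q C ^ n := by
  rw [← map_span_pow_eq_qIdeal_pow] at hb ⊢
  have h : ∀ b' : B, E (b' * b) ∈
      ((Ideal.span {(p : R), q - 1}) ^ n).map (algebraMap R C) := by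
    induction hb using Submodule.span_induction with
    | zero => simp
    | add y z _ _ hy hz =>
      intro b'
      rw [mul_add, _root_.map_add]
      exact Ideal.add_mem _ (hy b') (hz b')
    | mem y hy =>
      obtain ⟨r, hr, rfl⟩ := hy
      intro b'
      rw [mul_comm, ← Algebra.smul_def, map_smul, Algebra.smul_def]
      exact Ideal.mul_mem_right _ _ (Ideal.mem_map_of_mem _ hr)
    | smul a y hy h =>
      intro b'
      rw [smul_eq_mul, ← mul_assoc]
      exact h _
  simpa using h 1

/-! ### The completed pullback: density and rigidity. -/

section FrobeniusPullback

variable {p : ℕ} [Fact p.Prime] {R : Type u} [CommRing R] {δR : DeltaStructure p R} {q : R}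
  {A : Type u} [CommRing A] [Algebra R A]

theorem FrobeniusPullback.ext_eval {y z : FrobeniusPullback δR q A}
    (h : ∀ n, FrobeniusPullback.eval δR q A n y = FrobeniusPullback.eval δR q A n z) : y = z :=
  AdicCompletion.ext_evalₐ h

theorem FrobeniusPullback.exists_eval_eq_of_compatible (c : ℕ → UncompletedPullback δR A)
    (hc : ∀ n, c n - c (n + 1) ∈ UncompletedPullback.ideal δR q A ^ n) :
    ∃ z : FrobeniusPullback δR q A, ∀ n,
      FrobeniusPullback.eval δR q A n z = Ideal.Quotient.mk _ (c n) := by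
  refine ⟨AdicCompletion.mk _ _ (AdicCompletion.AdicCauchySequence.mk
    (UncompletedPullback.ideal δR q A) (UncompletedPullback δR A) c fun n => ?_), fun n => ?_⟩
  · rw [SModEq.sub_mem, smul_eq_mul, Ideal.mul_top]
    exact hc n
  · exact AdicCompletion.evalₐ_mk (UncompletedPullback.ideal δR q A) n _

theorem FrobeniusPullback.of_scalar (r : R) :
    FrobeniusPullback.of δR q A (UncompletedPullback.scalar δR A r) =
      algebraMap R (FrobeniusPullback δR q A) r := rfl

theorem FrobeniusPullback.map_ideal_pow (n : ℕ) :
    (UncompletedPullback.ideal δR q A ^ n).map (FrobeniusPullback.of δR q A) =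
      qIdeal p q (FrobeniusPullback δR q A) ^ n := by
  rw [UncompletedPullback.ideal_pow, Ideal.map_map, ← map_span_pow_eq_qIdeal_pow]
  rfl

/-- Density for the adic topology of `A'` itself: since the ideal is finitely generated, the kernel
of evaluation at level `n` is its `n`-th power times the completion. -/
theorem FrobeniusPullback.exists_sub_of_mem (n : ℕ) (z : FrobeniusPullback δR q A) :
    ∃ b, z - FrobeniusPullback.of δR q A b ∈ qIdeal p q (FrobeniusPullback δR q A) ^ n := by
  have hfg : (UncompletedPullback.ideal δR q A).FG := Submodule.fg_span (Set.toFinite _)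
  obtain ⟨y, rfl⟩ := AdicCompletion.mk_surjective _ _ z
  refine ⟨y n, ?_⟩
  rw [← FrobeniusPullback.map_ideal_pow]
  have h := AdicCompletion.pow_smul_top_eq_ker_eval (M := UncompletedPullback δR A) (n := n) hfg
  have h2 : AdicCompletion.mk _ _ y - algebraMap (UncompletedPullback δR A)
    (AdicCompletion (UncompletedPullback.ideal δR q A) (UncompletedPullback δR A)) (y n) ∈
      (AdicCompletion.eval (UncompletedPullback.ideal δR q A) (UncompletedPullback δR A) n).ker := by
    rw [LinearMap.mem_ker, _root_.map_sub]
    exact sub_eq_zero.mpr rfl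
  rw [← h, Ideal.smul_top_eq_map] at h2
  exact h2

/-- The map `a ↦ 1 ⊗ a` from `A` to `A'` as a ring homomorphism. -/
noncomputable def FrobeniusPullback.inclHom (δR : DeltaStructure p R) (q : R) (A : Type u)
    [CommRing A] [Algebra R A] : A →+* FrobeniusPullback δR q A :=
  (FrobeniusPullback.of δR q A).comp (Algebra.TensorProduct.includeRight :
    A →ₐ[R] AlgebraVia δR.frobenius ⊗[R] A).toRingHom

theorem FrobeniusPullback.inclHom_apply (a : A) :
    FrobeniusPullback.inclHom δR q A a = FrobeniusPullback.incl δR q a := rfl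

theorem FrobeniusPullback.inclHom_algebraMap (r : R) :
    FrobeniusPullback.inclHom δR q A (algebraMap R A r) =
      algebraMap R (FrobeniusPullback δR q A) (δR.frobenius r) := by
  rw [inclHom_apply, incl, UncompletedPullback.one_tmul_algebraMap, of_scalar]

theorem FrobeniusPullback.linearMap_eq_zero [IsHausdorff (qIdeal p q A) A]
    (E : FrobeniusPullback δR q A →ₗ[R] A)
    (hE : ∀ a : A, E (FrobeniusPullback.inclHom δR q A a) = 0) : E = 0 := by
  have hof : ∀ b, E (FrobeniusPullback.of δR q A b) = 0 := fun b => by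
    induction b using TensorProduct.induction_on with
    | zero => rw [_root_.map_zero, _root_.map_zero]
    | add y z hy hz => rw [_root_.map_add, _root_.map_add, hy, hz, add_zero]
    | tmul r a =>
      have := UncompletedPullback.tmul_eq (δR := δR) (AlgebraVia.val δR.frobenius r) a
      change r ⊗ₜ[R] a = _ at this
      rw [this, _root_.map_mul, of_scalar, ← Algebra.smul_def, map_smul]
      exact (congrArg _ (hE a)).trans (smul_zero _)
  ext z
  refine (IsHausdorff.eq_iff_smodEq (I := qIdeal p q A)).mpr fun n => ?_
  rw [SModEq.sub_mem, smul_eq_mul, Ideal.mul_top, LinearMap.zero_apply, sub_zero]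
  obtain ⟨b, hb⟩ := FrobeniusPullback.exists_sub_of_mem n z
  have := LinearMap.map_mem_qIdeal_pow p q E hb
  rwa [_root_.map_sub, hof, sub_zero] at this

/-- By density and `R`-linearity it suffices to treat the elements `1 ⊗ a`. There `E` is a twisted
derivation of `A` that vanishes on polynomials in `x`, so its values lie in every power of `(p, q -
1)`, and `A` is separated. -/
theorem FrobeniusPullback.twisted_derivation_eq_zero [IsHausdorff (qIdeal p q A) A]
    (hq : δR.δ q = 0) {x : A} (hx : IsTopEtaleCoordinate (Ideal.span {(p : R), q - 1}) x)
    (ψ₁ ψ₂ : FrobeniusPullback δR q A →ₐ[R] A) (hψ : ∀ z, ψ₂ z - ψ₁ z ∈ qIdeal p q A)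
    (E : FrobeniusPullback δR q A →ₗ[R] A)
    (hmul : ∀ y z, E (y * z) = E y * ψ₁ z + ψ₂ y * E z)
    (hE : E (FrobeniusPullback.incl δR q x) = 0) : E = 0 := by
  let f := (Polynomial.aeval (R := R) x).toRingHom
  let ι := FrobeniusPullback.inclHom δR q A
  refine FrobeniusPullback.linearMap_eq_zero E fun a => ?_
  refine (IsHausdorff.eq_iff_smodEq (I := qIdeal p q A)).mpr fun n => ?_
  rw [SModEq.sub_mem, smul_eq_mul, Ideal.mul_top, sub_zero]
  refine mem_pow_of_twisted_derivation f _ (hx 1).formallyUnramified (qIdeal p q A)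
    ((ψ₁ : _ →+* A).comp ι) ((ψ₂ : _ →+* A).comp ι) (fun a => hψ _) (fun t ht => ?_)
    (E.toAddMonoidHom.comp ι.toAddMonoidHom) (fun a b => ?_) (fun t => ?_) n a
  · have : ((Ideal.span {(p : R), q - 1}) ^ 1).map (Polynomial.C : R →+* R[X]) ≤
        (qIdeal p q A).comap (((ψ₁ : _ →+* A).comp ι).comp f) := by
      rw [Ideal.map_le_iff_le_comap]
      intro r hr
      change ψ₁ (ι (Polynomial.aeval x (Polynomial.C r))) ∈ qIdeal p q A
      rw [Polynomial.aeval_C, FrobeniusPullback.inclHom_algebraMap, AlgHom.commutes]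
      have := Ideal.mem_map_of_mem (algebraMap R A) (DeltaStructure.frobenius_mem_span_pow hq hr)
      rwa [map_span_pow_eq_qIdeal_pow, pow_one] at this
    exact this ht
  · change E (ι (a * b)) = E (ι a) * ψ₁ (ι b) + ψ₂ (ι a) * E (ι b)
    rw [_root_.map_mul, hmul]
  · change E (ι (Polynomial.aeval x t)) = 0
    have h1 : E 1 = 0 := by
      have := hmul 1 1
      rw [mul_one, _root_.map_one ψ₁, _root_.map_one ψ₂, one_mul, mul_one] at this
      exact left_eq_add.mp this
    have hk : ∀ k, E (FrobeniusPullback.incl δR q x ^ k) = 0 := fun k => by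
      induction k with
      | zero => rw [pow_zero, h1]
      | succ k ih => rw [pow_succ, hmul, ih, hE, zero_mul, mul_zero, add_zero]
    induction t using Polynomial.induction_on' with
    | add s t hs ht => rw [_root_.map_add, _root_.map_add, _root_.map_add, hs, ht, add_zero]
    | monomial k r =>
      rw [Polynomial.aeval_monomial, _root_.map_mul, FrobeniusPullback.inclHom_algebraMap,
        ← Algebra.smul_def, map_smul, _root_.map_pow, FrobeniusPullback.inclHom_apply, hk,
        smul_zero]

end FrobeniusPullback

/-! ### Passage to the limit: `A` is free over `A'`. -/

section RelativeFrobenius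

variable {p : ℕ} [Fact p.Prime] {R : Type u} [CommRing R] {δR : DeltaStructure p R} {q : R}
  {A : Type u} [CommRing A] [Algebra R A] [IsAdicComplete (qIdeal p q A) A]
  {δA : DeltaStructure p A} (hδ : ∀ r : R, δA.δ (algebraMap R A r) = algebraMap R A (δR.δ r))

theorem relativeFrobenius_sub_uncompletedFrobenius_mem (n : ℕ) (z : FrobeniusPullback δR q A)
    (b : UncompletedPullback δR A)
    (h : FrobeniusPullback.eval δR q A n z = Ideal.Quotient.mk _ b) :
    relativeFrobenius δR q δA hδ z - uncompletedFrobenius δR δA hδ b ∈ qIdeal p q A ^ n := by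
  rw [← Ideal.Quotient.mk_eq_mk_iff_sub_mem]
  refine (IsAdicComplete.mk_liftRingHom (qIdeal p q A) _
    (relativeFrobenius_compat δR q δA hδ) n _).trans ?_
  rw [RingHom.comp_apply, h]
  rfl

theorem sum_relativeFrobenius_sub_mem (x : A) (n : ℕ) (z : Fin p → FrobeniusPullback δR q A)
    (b : Fin p → UncompletedPullback δR A)
    (h : ∀ i, FrobeniusPullback.eval δR q A n (z i) = Ideal.Quotient.mk _ (b i)) :
    ∑ i, relativeFrobenius δR q δA hδ (z i) * x ^ (i : ℕ) -
      ∑ i, uncompletedFrobenius δR δA hδ (b i) * x ^ (i : ℕ) ∈ qIdeal p q A ^ n := by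
  rw [← Finset.sum_sub_distrib]
  refine Ideal.sum_mem _ fun i _ => ?_
  rw [← sub_mul]
  exact Ideal.mul_mem_right _ _ (relativeFrobenius_sub_uncompletedFrobenius_mem hδ n _ _ (h i))

theorem eq_zero_of_sum_relativeFrobenius (hq : δR.δ q = 0) {x : A}
    (hx : IsTopEtaleCoordinate (Ideal.span {(p : R), q - 1}) x) (hδx : δA.δ x = 0)
    (z : Fin p → FrobeniusPullback δR q A)
    (h : ∑ i, relativeFrobenius δR q δA hδ (z i) * x ^ (i : ℕ) = 0) (i : Fin p) : z i = 0 := by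
  refine FrobeniusPullback.ext_eval fun n => ?_
  choose b hb _ using fun i => FrobeniusPullback.exists_eval_eq δR q A (le_refl n) (z i)
  rw [hb, _root_.map_zero, Ideal.Quotient.eq_zero_iff_mem]
  refine mem_pow_of_sum_uncompletedFrobenius_mem hδ hq n hx hδx b ?_ i
  have := sum_relativeFrobenius_sub_mem hδ x n z b hb
  rwa [h, zero_sub, neg_mem_iff] at this

theorem exists_eq_sum_relativeFrobenius (hq : δR.δ q = 0) {x : A}
    (hx : IsTopEtaleCoordinate (Ideal.span {(p : R), q - 1}) x) (hδx : δA.δ x = 0) (a : A) :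
    ∃ z : Fin p → FrobeniusPullback δR q A,
      ∑ i, relativeFrobenius δR q δA hδ (z i) * x ^ (i : ℕ) = a := by
  choose b hb using fun n => exists_sub_sum_uncompletedFrobenius_mem (q := q) hδ hx hδx n a
  -- Independence modulo the `n`-th power makes the approximate coefficients compatible, so they
  -- converge in `A'`.
  have hc : ∀ i n, b n i - b (n + 1) i ∈ UncompletedPullback.ideal δR q A ^ n := fun i n => by
    refine mem_pow_of_sum_uncompletedFrobenius_mem hδ hq n hx hδx
      (fun i => b n i - b (n + 1) i) ?_ i
    have := Ideal.sub_mem _ (Ideal.pow_le_pow_right n.le_succ (hb (n + 1))) (hb n)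
    convert this using 1
    simp only [_root_.map_sub, sub_mul, Finset.sum_sub_distrib]
    ring
  choose z hz using fun i =>
    FrobeniusPullback.exists_eval_eq_of_compatible (fun n => b n i) (hc i)
  refine ⟨z, ?_⟩
  refine (IsHausdorff.eq_iff_smodEq (I := qIdeal p q A)).mpr fun n => ?_
  rw [SModEq.sub_mem, smul_eq_mul, Ideal.mul_top]
  have := Ideal.sub_mem _ (sum_relativeFrobenius_sub_mem hδ x n z (b n) fun i => hz i n) (hb n)
  convert this using 1
  ring

theorem exists_basis_relativeFrobenius (hq : δR.δ q = 0) {x : A}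
    (hx : IsTopEtaleCoordinate (Ideal.span {(p : R), q - 1}) x) (hδx : δA.δ x = 0)
    [Algebra (FrobeniusPullback δR q A) A]
    (hF : algebraMap (FrobeniusPullback δR q A) A = relativeFrobenius δR q δA hδ) :
    ∃ b : Module.Basis (Fin p) (FrobeniusPullback δR q A) A, ∀ i, b i = x ^ (i : ℕ) := by
  have hsmul : ∀ (z : FrobeniusPullback δR q A) (a : A),
      z • a = relativeFrobenius δR q δA hδ z * a := fun z a => by rw [Algebra.smul_def, hF]
  refine ⟨Module.Basis.mk (v := fun i : Fin p => x ^ (i : ℕ)) ?_ ?_, fun i => Module.Basis.mk_apply _ _ i⟩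
  · rw [Fintype.linearIndependent_iff]
    intro z hz
    simp only [hsmul] at hz
    exact eq_zero_of_sum_relativeFrobenius hδ hq hx hδx z hz
  · intro a _
    obtain ⟨z, rfl⟩ := exists_eq_sum_relativeFrobenius hδ hq hx hδx a
    refine Submodule.sum_mem _ fun i _ => ?_
    rw [← hsmul]
    exact Submodule.smul_mem _ _ (Submodule.subset_span ⟨i, rfl⟩)

end RelativeFrobenius

/-! ### Twisted derivatives of powers of the coordinate. -/

section TwistedDerivative

variable {R A : Type*} [CommRing R] [CommRing A] [Algebra R A] {q : R} {x : A} {σ : A →ₐ[R] A}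

theorem qNumber_succ (q : R) (n : ℕ) : qNumber q (n + 1) = 1 + q * qNumber q n := by
  rw [qNumber, qNumber, Finset.sum_range_succ', Finset.mul_sum, pow_zero, add_comm]
  simp only [pow_succ']

theorem IsTwistedDerivative.map_one {D : A →ₗ[R] A} (hD : IsTwistedDerivative σ x D) :
    D 1 = 0 := by
  have := hD.leibniz 1 1
  rw [mul_one, _root_.map_one σ, one_mul, mul_one] at this
  exact left_eq_add.mp this

theorem IsTwistedDerivative.map_pow (hσ : σ x = algebraMap R A q * x) {D : A →ₗ[R] A}
    (hD : IsTwistedDerivative σ x D) (n : ℕ) :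
    D (x ^ (n + 1)) = qNumber q (n + 1) • x ^ n := by
  induction n with
  | zero => simp [hD.map_coordinate, qNumber]
  | succ n ih =>
    rw [pow_succ', hD.leibniz, hD.map_coordinate, ih, hσ, qNumber_succ q (n + 1), add_smul,
      one_smul, mul_smul, one_mul, pow_succ', Algebra.smul_def, Algebra.smul_def, Algebra.smul_def]
    ring

theorem IsQEndomorphism.sub_mem_qIdeal (hσ : IsQEndomorphism q x σ) (p : ℕ) (a : A) :
    σ a - a ∈ qIdeal p q A :=
  Ideal.span_mono (Set.subset_insert _ _) (hσ.congr_id a)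

theorem IsQEndomorphism.pow_sub_mem_qIdeal (hσ : IsQEndomorphism q x σ) (p n : ℕ) (a : A) :
    (σ ^ n) a - a ∈ qIdeal p q A := by
  induction n with
  | zero => simp
  | succ n ih =>
    have := Ideal.add_mem _ (hσ.sub_mem_qIdeal p ((σ ^ n) a)) ih
    rw [pow_succ']
    convert this using 1
    rw [sub_add_sub_cancel]
    rfl

theorem IsQEndomorphism.pow_map_coordinate (hσ : IsQEndomorphism q x σ) (n : ℕ) :
    (σ ^ n) x = algebraMap R A (q ^ n) * x := by
  induction n with
  | zero => simp
  | succ n ih =>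
    rw [pow_succ']
    change σ ((σ ^ n) x) = _
    rw [ih, _root_.map_mul, AlgHom.commutes, hσ.map_coordinate, pow_succ, _root_.map_mul, mul_assoc]

end TwistedDerivative

/-! ### The relative Frobenius against `σ` and the twisted derivatives. -/

section Compatibility

variable {p : ℕ} [Fact p.Prime] {R : Type u} [CommRing R] {δR : DeltaStructure p R} {q : R}
  {A : Type u} [CommRing A] [Algebra R A] [IsAdicComplete (qIdeal p q A) A]
  {δA : DeltaStructure p A} (hδ : ∀ r : R, δA.δ (algebraMap R A r) = algebraMap R A (δR.δ r))
  {x : A} [Algebra (FrobeniusPullback δR q A) A] {σ : A →ₐ[R] A} {D : A →ₗ[R] A}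
  {σ' : FrobeniusPullback δR q A →ₐ[R] FrobeniusPullback δR q A}
  {D' : FrobeniusPullback δR q A →ₗ[R] FrobeniusPullback δR q A}

include hδ in
theorem algebraMap_incl_coordinate (hδx : δA.δ x = 0)
    (hF : algebraMap (FrobeniusPullback δR q A) A = relativeFrobenius δR q δA hδ) :
    algebraMap (FrobeniusPullback δR q A) A (FrobeniusPullback.incl δR q x) = x ^ p := by
  rw [hF, relativeFrobenius_incl, DeltaStructure.frobenius_of_delta_eq_zero hδx]

variable [IsScalarTower R (FrobeniusPullback δR q A) A]

/-- The difference of the two ring homomorphisms is a twisted derivation relative to them, and both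
send `x'` to `q ^ p x ^ p`; rigidity concludes. -/
theorem endomorphism_algebraMap (hq : δR.δ q = 0)
    (hx : IsTopEtaleCoordinate (Ideal.span {(p : R), q - 1}) x)
    (hF : algebraMap (FrobeniusPullback δR q A) A (FrobeniusPullback.incl δR q x) = x ^ p)
    (hσ : IsQEndomorphism q x σ) (hσ' : IsQEndomorphism q (FrobeniusPullback.incl δR q x) σ')
    (z : FrobeniusPullback δR q A) :
    σ (algebraMap _ A z) = algebraMap _ A ((σ' ^ p) z) := by
  let F : FrobeniusPullback δR q A →ₐ[R] A := IsScalarTower.toAlgHom R _ A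
  let ψ₁ := σ.comp F
  let ψ₂ := F.comp (σ' ^ p)
  have := FrobeniusPullback.twisted_derivation_eq_zero hq hx ψ₁ ψ₂ (fun z => ?_)
    (ψ₁.toLinearMap - ψ₂.toLinearMap) (fun y z => ?_) ?_
  · exact sub_eq_zero.mp (LinearMap.congr_fun this z)
  · have h1 := LinearMap.map_mem_qIdeal_pow p q F.toLinearMap (n := 1)
      (by simpa using hσ'.pow_sub_mem_qIdeal p p z)
    have h2 := Ideal.sub_mem _ (by simpa using h1) (hσ.sub_mem_qIdeal p (F z))
    convert h2 using 1
    change F _ - σ (F z) = _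
    rw [← _root_.map_sub]
    simp
  · simp only [LinearMap.sub_apply, AlgHom.toLinearMap_apply, _root_.map_mul]
    ring
  · change σ (algebraMap _ A _) - algebraMap _ A ((σ' ^ p) _) = 0
    rw [hσ'.pow_map_coordinate, _root_.map_mul, ← IsScalarTower.algebraMap_apply, hF,
      _root_.map_pow, hσ.map_coordinate, mul_pow, _root_.map_pow, sub_self]

/-- The difference of the two sides is a derivation twisted by `F` and `σ ∘ F`. It kills `x'`
because `∂_q (x ^ p) = (p)_q x ^ (p - 1)`. -/
theorem derivative_algebraMap (hq : δR.δ q = 0)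
    (hx : IsTopEtaleCoordinate (Ideal.span {(p : R), q - 1}) x)
    (hF : algebraMap (FrobeniusPullback δR q A) A (FrobeniusPullback.incl δR q x) = x ^ p)
    (hσ : IsQEndomorphism q x σ) (hσ' : IsQEndomorphism q (FrobeniusPullback.incl δR q x) σ')
    (hD : IsTwistedDerivative σ x D)
    (hD' : IsTwistedDerivative (σ' ^ p) (FrobeniusPullback.incl δR q x) D')
    (z : FrobeniusPullback δR q A) :
    D (algebraMap _ A z) = qNumber q p • (x ^ (p - 1) * algebraMap _ A (D' z)) := by
  let F : FrobeniusPullback δR q A →ₐ[R] A := IsScalarTower.toAlgHom R _ A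
  have hFz : ∀ z, F z = algebraMap _ A z := fun _ => rfl
  have hFσ := endomorphism_algebraMap hq hx hF hσ hσ'
  have := FrobeniusPullback.twisted_derivation_eq_zero hq hx F (σ.comp F)
    (fun z => hσ.sub_mem_qIdeal p (F z))
    (D ∘ₗ F.toLinearMap -
      qNumber q p • (LinearMap.mulLeft R (x ^ (p - 1)) ∘ₗ F.toLinearMap ∘ₗ D'))
    (fun y z => ?_) ?_
  · exact sub_eq_zero.mp (LinearMap.congr_fun this z)
  · simp only [LinearMap.sub_apply, LinearMap.smul_apply, LinearMap.comp_apply,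
      AlgHom.toLinearMap_apply, LinearMap.mulLeft_apply, _root_.map_mul, AlgHom.comp_apply,
      hD.leibniz, hD'.leibniz, _root_.map_add, hFz, hFσ, Algebra.smul_def]
    ring
  · simp only [LinearMap.sub_apply, LinearMap.smul_apply, LinearMap.comp_apply,
      AlgHom.toLinearMap_apply, LinearMap.mulLeft_apply, hFz, hF, hD'.map_coordinate,
      _root_.map_one, mul_one]
    obtain ⟨m, hm⟩ := Nat.exists_eq_succ_of_ne_zero (Fact.out : p.Prime).ne_zero
    rw [hm, hD.map_pow hσ.map_coordinate, Nat.succ_sub_one, sub_self]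

end Compatibility

/-! ### Topologically nilpotent perturbations of units. -/

section TopologicallyNilpotent

variable {R M : Type*} [CommRing R] [AddCommGroup M] [Module R M] {J : Ideal R} {T : M →ₗ[R] M}

theorem LinearMap.map_mem_pow_smul_top (T : M →ₗ[R] M) {n : ℕ} {m : M}
    (hm : m ∈ (J ^ n • ⊤ : Submodule R M)) : T m ∈ (J ^ n • ⊤ : Submodule R M) := by
  have := Submodule.mem_map_of_mem (f := T) hm
  rw [Submodule.map_smul''] at this
  exact Submodule.smul_mono le_rfl le_top this

/-- The exponent may depend on the vector, but an element of `J ^ n M` is a finite combination of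
vectors, so a common exponent moves it into `J ^ (n + 1) M`. -/
theorem LinearMap.exists_pow_mem_pow_smul_top
    (hT : ∀ m, ∃ k, (T ^ k) m ∈ (J • ⊤ : Submodule R M)) (m : M) (n : ℕ) :
    ∃ K, ∀ k, K ≤ k → (T ^ k) m ∈ (J ^ n • ⊤ : Submodule R M) := by
  have mono : ∀ {n k l : ℕ} {y : M}, k ≤ l → (T ^ k) y ∈ (J ^ n • ⊤ : Submodule R M) →
      (T ^ l) y ∈ (J ^ n • ⊤ : Submodule R M) := by
    intro n k l y hkl hy
    obtain ⟨d, rfl⟩ := Nat.exists_eq_add_of_le' hkl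
    rw [pow_add]
    exact LinearMap.map_mem_pow_smul_top (T ^ d) hy
  have step : ∀ n, ∀ y ∈ (J ^ n • ⊤ : Submodule R M),
      ∃ k, (T ^ k) y ∈ (J ^ (n + 1) • ⊤ : Submodule R M) := by
    intro n y hy
    induction hy using Submodule.smul_induction_on' with
    | smul r hr m _ =>
      obtain ⟨k, hk⟩ := hT m
      refine ⟨k, ?_⟩
      rw [map_smul, pow_succ, Submodule.mul_smul]
      exact Submodule.smul_mem_smul hr hk
    | add y _ z _ hy hz =>
      obtain ⟨k, hk⟩ := hy
      obtain ⟨l, hl⟩ := hz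
      refine ⟨max k l, ?_⟩
      rw [_root_.map_add]
      exact Submodule.add_mem _ (mono (le_max_left _ _) hk) (mono (le_max_right _ _) hl)
  have key : ∃ K, (T ^ K) m ∈ (J ^ n • ⊤ : Submodule R M) := by
    induction n with
    | zero => exact ⟨0, by simp⟩
    | succ n ih =>
      obtain ⟨K, hK⟩ := ih
      obtain ⟨k, hk⟩ := step n _ hK
      exact ⟨k + K, by rw [pow_add T]; exact hk⟩
  obtain ⟨K, hK⟩ := key
  exact ⟨K, fun k hk => mono hk hK⟩

/-- A fixed vector of `T` lies in every `J ^ n M`; the inverse is the pointwise convergent geometric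
series. -/
theorem LinearMap.bijective_one_sub_of_topologically_nilpotent [IsAdicComplete J M]
    (hT : ∀ m n, ∃ K, ∀ k, K ≤ k → (T ^ k) m ∈ (J ^ n • ⊤ : Submodule R M)) :
    Function.Bijective ((1 : M →ₗ[R] M) - T) := by
  constructor
  · rw [injective_iff_map_eq_zero]
    intro m hm
    have h1 : T m = m := (sub_eq_zero.mp hm).symm
    have h2 : ∀ k, (T ^ k) m = m := fun k => by
      induction k with
      | zero => rfl
      | succ k ih => rw [pow_succ, Module.End.mul_apply, h1, ih]
    refine (IsHausdorff.eq_iff_smodEq (I := J)).mpr fun n => ?_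
    rw [SModEq.zero]
    obtain ⟨K, hK⟩ := hT m n
    rw [← h2 K]
    exact hK K le_rfl
  · intro t
    choose K hK using hT t
    -- A monotone bound is needed for consecutive partial sums to differ only by tail terms.
    let K' : ℕ → ℕ := fun n => (Finset.range (n + 1)).sup K
    have hKK' : ∀ n, K n ≤ K' n := fun n =>
      Finset.le_sup (f := K) (Finset.mem_range.mpr n.lt_succ_self)
    have hmono : Monotone K' := fun m n hmn =>
      Finset.sup_mono (Finset.range_mono (Nat.succ_le_succ hmn))
    let S : ℕ → M := fun k => ∑ j ∈ Finset.range k, (T ^ j) t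
    have hS : ∀ k, ((1 : M →ₗ[R] M) - T) (S k) = t - (T ^ k) t := fun k => by
      induction k with
      | zero => simp [S]
      | succ k ih =>
        have : S (k + 1) = S k + (T ^ k) t := Finset.sum_range_succ _ _
        rw [this, _root_.map_add, ih, pow_succ', LinearMap.sub_apply, Module.End.one_apply,
          Module.End.mul_apply]
        abel
    obtain ⟨L, hL⟩ := IsPrecomplete.prec (I := J) (M := M) inferInstance
      (f := fun n => S (K' n)) (fun {m n} hmn => by
        rw [SModEq.comm, SModEq.sub_mem]
        rw [← Finset.sum_Ico_eq_sub _ (hmono hmn)]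
        exact Submodule.sum_mem _ fun j hj =>
          hK m j ((hKK' m).trans (Finset.mem_Ico.mp hj).1))
    refine ⟨L, (IsHausdorff.eq_iff_smodEq (I := J)).mpr fun n => ?_⟩
    have h1 := hL n
    rw [SModEq.sub_mem] at h1 ⊢
    have h2 := LinearMap.map_mem_pow_smul_top ((1 : M →ₗ[R] M) - T) h1
    rw [_root_.map_sub, hS] at h2
    have h3 := Submodule.sub_mem _ (Submodule.neg_mem _ h2) (hK n (K' n) (hKK' n))
    convert h3 using 1
    abel

theorem LinearMap.bijective_smul_one_add_of_topologically_nilpotent [IsAdicComplete J M] {c : R}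
    (hc : IsUnit c) (hT : ∀ m, ∃ k, (T ^ k) m ∈ (J • ⊤ : Submodule R M)) :
    Function.Bijective (c • (1 : M →ₗ[R] M) + T) := by
  obtain ⟨c, rfl⟩ := hc
  let N : M →ₗ[R] M := (-((c⁻¹ : Rˣ) : R)) • T
  have h1 : Function.Bijective ((1 : M →ₗ[R] M) - N) := by
    refine bijective_one_sub_of_topologically_nilpotent
      (LinearMap.exists_pow_mem_pow_smul_top (J := J) fun m => ?_)
    obtain ⟨k, hk⟩ := hT m
    refine ⟨k, ?_⟩
    rw [smul_pow, LinearMap.smul_apply]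
    exact Submodule.smul_mem _ _ hk
  have h2 : ⇑((c : R) • (1 : M →ₗ[R] M) + T) = (fun m => c • m) ∘ ⇑((1 : M →ₗ[R] M) - N) := by
    funext m
    simp only [N, Function.comp_apply, LinearMap.add_apply, LinearMap.smul_apply,
      Module.End.one_apply, neg_smul, sub_neg_eq_add, smul_add]
    rw [← Units.smul_def, ← Units.smul_def, smul_inv_smul]
  rw [h2]
  exact (MulAction.bijective c).comp h1

end TopologicallyNilpotent

/-! ### The `q`-numbers in the base ring. -/

section QNumber

variable {R : Type*} [CommRing R]

theorem qNumber_mem_span (p : ℕ) (q : R) : qNumber q p ∈ Ideal.span {(p : R), q - 1} := by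
  have h : qNumber q p = ∑ i ∈ Finset.range p, (q ^ i - 1) + p := by
    rw [Finset.sum_sub_distrib]
    simp [qNumber]
  rw [h]
  refine Ideal.add_mem _ (Ideal.sum_mem _ fun i _ => ?_) (Ideal.subset_span (Set.mem_insert _ _))
  exact Ideal.mem_of_dvd _ (sub_one_dvd_pow_sub_one q i)
    (Ideal.subset_span (Set.mem_insert_of_mem _ rfl))

/-- At `q = 1` modulo `p` the polynomial `1 + ⋯ + X ^ (i - 1)` becomes `i`, which is nonzero in
`ZMod p`, so it is invertible in the localization at `(p, q - 1)`. -/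
theorem IsQBase.isUnit_qNumber {p : ℕ} [Fact p.Prime] {δR : DeltaStructure p R} {q : R}
    (hq : IsQBase p δR q) {i : ℕ} (h0 : 0 < i) (hi : i < p) : IsUnit (qNumber q i) := by
  have h := hq.isUnit_aeval (∑ j ∈ Finset.range i, .X ^ j) fun hmem => ?_
  · simpa [qNumber] using h
  · let e : ℤ[X] →+* ZMod p := Polynomial.eval₂RingHom (Int.castRingHom _) 1
    have hle : Ideal.span {Polynomial.C (p : ℤ), Polynomial.X - 1} ≤ RingHom.ker e := by
      rw [Ideal.span_le]
      rintro _ (rfl | rfl) <;> simp [e, RingHom.mem_ker]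
    have := hle hmem
    rw [RingHom.mem_ker] at this
    simp only [e, Polynomial.coe_eval₂RingHom, Polynomial.eval₂_finsetSum, Polynomial.eval₂_X_pow,
      one_pow, Finset.sum_const, Finset.card_range, nsmul_eq_mul, mul_one] at this
    rw [ZMod.natCast_eq_zero_iff] at this
    exact Nat.not_dvd_of_pos_of_lt h0 hi this

end QNumber

/-! ### The induced connection on the pullback. -/

section ModulePullback

variable {p : ℕ} {R A B M : Type*} [CommRing R] [CommRing A] [CommRing B] [Algebra R A]
  [Algebra R B] [Algebra B A] [IsScalarTower R B A] [AddCommGroup M] [Module R M] [Module B M]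
  [IsScalarTower R B M] {q : R} {x : A} {x' : B} {σ : A →ₐ[R] A} {D : A →ₗ[R] A}
  {σ' : B →ₐ[R] B} {D' : B →ₗ[R] B} {θ' : M →ₗ[R] M}

/-- Completeness is moved from `B` to `R` because `θ'` is only `R`-linear. -/
theorem isAdicComplete_span_of_qIdeal [h : IsAdicComplete (qIdeal p q B) M] :
    IsAdicComplete (Ideal.span {(p : R), q - 1}) M := by
  have h1 : (Ideal.span {(p : R), q - 1}).map (algebraMap R B) = qIdeal p q B := by
    simpa using map_span_pow_eq_qIdeal_pow p q B 1
  rw [← h1] at h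
  exact { (IsHausdorff.map_algebraMap_iff (S := B)).mp h.toIsHausdorff,
    (IsPrecomplete.map_algebraMap_iff (S := B)).mp h.toIsPrecomplete with }

theorem mem_span_smul_top_iff (m : M) : m ∈ (Ideal.span {(p : R), q - 1} • ⊤ : Submodule R M) ↔
    m ∈ (qIdeal p q B • ⊤ : Submodule B M) := by
  have h1 : (Ideal.span {(p : R), q - 1}).map (algebraMap R B) = qIdeal p q B := by
    simpa using map_span_pow_eq_qIdeal_pow p q B 1
  rw [← h1, ← Submodule.restrictScalars_mem R (Ideal.map _ _ • ⊤ : Submodule B M),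
    Ideal.smul_restrictScalars, Submodule.restrictScalars_top]

/-- Since `(p)_q ∈ (p, q - 1)`, the operator `θ'` commutes with powers of `x'` modulo this ideal up
to powers of `q`. Hence `(r x' θ') ^ k` is a scalar times `x' ^ k θ' ^ k`, and quasi-nilpotence of
`θ'` passes to `r x' θ'`. -/
theorem IsTwistedConnectionNegOne.exists_pow_mem
    (hσ' : (σ' ^ p) x' = algebraMap R B (q ^ p) * x')
    (hθ' : IsTwistedConnectionNegOne p q σ' D' θ')
    (hnil : IsTopQuasiNilpotent (qIdeal p q B) θ') (r : R) (m : M) :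
    ∃ k, ((r • (Module.toModuleEnd R (S := B) M x' * θ')) ^ k) m ∈
      (Ideal.span {(p : R), q - 1} • ⊤ : Submodule R M) := by
  set T : M →ₗ[R] M := r • (Module.toModuleEnd R (S := B) M x' * θ')
  have hTm : ∀ m, T m = r • x' • θ' m := fun _ => rfl
  have key : ∀ k, ∃ c : R, (T ^ k) m - c • x' ^ k • (θ' ^ k) m ∈
      (Ideal.span {(p : R), q - 1} • ⊤ : Submodule R M) := by
    intro k
    induction k with
    | zero => exact ⟨1, by simp⟩
    | succ k ih =>
      obtain ⟨c, hc⟩ := ih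
      -- The factor `q ^ (p * k)` comes from `σ' ^ p` acting on `x' ^ k`.
      refine ⟨r * c * q ^ (p * k), ?_⟩
      have h1 := LinearMap.map_mem_pow_smul_top (n := 1) T (by simpa using hc)
      rw [pow_one, _root_.map_sub, map_smul, hTm (x' ^ k • _), hθ'] at h1
      have h2 : (σ' ^ p) (x' ^ k) = algebraMap R B (q ^ (p * k)) * x' ^ k := by
        rw [_root_.map_pow, hσ', mul_pow, ← _root_.map_pow, ← pow_mul]
      have h3 : (c * r) • x' • (qNumber q p • (D' (x' ^ k) • (θ' ^ k) m)) ∈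
          (Ideal.span {(p : R), q - 1} • ⊤ : Submodule R M) := by
        rw [smul_comm x' (qNumber q p), smul_comm]
        exact Submodule.smul_mem_smul (qNumber_mem_span p q) trivial
      convert Submodule.add_mem _ h1 h3 using 1
      have h4 : (algebraMap R B (q ^ (p * k)) * x' ^ k) • θ' ((θ' ^ k) m) =
          q ^ (p * k) • x' ^ k • θ' ((θ' ^ k) m) := by rw [mul_smul, algebraMap_smul]
      have h5 : (r * c * q ^ (p * k)) • x' ^ (k + 1) • (θ' ^ (k + 1)) m =
          c • r • x' • q ^ (p * k) • x' ^ k • θ' ((θ' ^ k) m) := by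
        rw [pow_succ' θ', Module.End.mul_apply, pow_succ' x', mul_smul x' (x' ^ k), mul_comm r c,
          mul_smul (c * r), mul_smul c r, smul_comm (q ^ (p * k)) x']
      rw [pow_succ' T, Module.End.mul_apply, h5, h2, h4, smul_add, smul_add, smul_add, mul_smul c r]
      abel
  obtain ⟨K, hK⟩ := hnil m 1
  refine ⟨K, ?_⟩
  obtain ⟨c, hc⟩ := key K
  have h1 : c • x' ^ K • (θ' ^ K) m ∈ (Ideal.span {(p : R), q - 1} • ⊤ : Submodule R M) := by
    refine Submodule.smul_mem _ _ ?_
    rw [mem_span_smul_top_iff (B := B)]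
    refine Submodule.smul_mem _ _ ?_
    simpa using hK K le_rfl
  simpa using Submodule.add_mem _ hc h1

theorem IsTwistedConnection.map_tmul {θ : A ⊗[B] M →ₗ[R] A ⊗[B] M}
    (hθ : IsTwistedConnection σ D θ)
    (hθ1 : ∀ s, θ (tensorLeft R 1 s) = tensorLeft R (x ^ (p - 1)) (θ' s)) (a : A) (s : M) :
    θ (a ⊗ₜ s) = D a ⊗ₜ s + (σ a * x ^ (p - 1)) ⊗ₜ θ' s := by
  have h1 : a ⊗ₜ[B] s = a • ((1 : A) ⊗ₜ[B] s) := by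
    rw [TensorProduct.smul_tmul', smul_eq_mul, mul_one]
  have h2 := hθ1 s
  change θ ((1 : A) ⊗ₜ s) = (x ^ (p - 1)) ⊗ₜ θ' s at h2
  rw [h1, hθ, h2, TensorProduct.smul_tmul', TensorProduct.smul_tmul', smul_eq_mul, smul_eq_mul,
    mul_one]

/-- The value on `a ⊗ s` is forced to be `D a ⊗ s + σ a x ^ (p - 1) ⊗ θ' s`. It is balanced over `B`
because the term `(p)_q x ^ (p - 1) D' b` in the derivative of `b` is exactly the correction in the
Leibniz rule of level `-1`. -/
theorem existsUnique_isTwistedConnection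
    (hσF : ∀ b, σ (algebraMap B A b) = algebraMap B A ((σ' ^ p) b))
    (hDF : ∀ b, D (algebraMap B A b) = qNumber q p • (x ^ (p - 1) * algebraMap B A (D' b)))
    (hD : IsTwistedDerivative σ x D) (hθ' : IsTwistedConnectionNegOne p q σ' D' θ') :
    ∃! θ : A ⊗[B] M →ₗ[R] A ⊗[B] M, IsTwistedConnection σ D θ ∧
      ∀ s : M, θ (tensorLeft R 1 s) = tensorLeft R (x ^ (p - 1)) (θ' s) := by
  let φ : A → M → A ⊗[B] M := fun a s => D a ⊗ₜ s + (σ a * x ^ (p - 1)) ⊗ₜ θ' s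
  -- Only biadditivity is available, as `D` and `θ'` are not `B`-linear; `R`-linearity is recovered
  -- afterwards.
  let Φ : A →+ M →+ A ⊗[B] M := AddMonoidHom.mk' (fun a => AddMonoidHom.mk' (φ a) fun s t => by
      simp only [φ, _root_.map_add, TensorProduct.tmul_add]
      abel) fun a b => by
    ext s
    simp only [φ, AddMonoidHom.mk'_apply, AddMonoidHom.add_apply, _root_.map_add, add_mul,
      TensorProduct.add_tmul]
    abel
  have hΦ : ∀ (b : B) a s, Φ (b • a) s = Φ a (b • s) := by
    intro b a s
    change φ (b • a) s = φ a (b • s)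
    simp only [φ]
    -- The Leibniz rule is applied to `a * b`, not `b * a`, so that `b` leaves `D a` untwisted and
    -- `σ` falls on `a`.
    have h1 : D (b • a) = b • D a + (qNumber q p • D' b) • (σ a * x ^ (p - 1)) := by
      rw [Algebra.smul_def, mul_comm, hD.leibniz, hDF, Algebra.smul_def b, smul_assoc,
        Algebra.smul_def (D' b), mul_smul_comm]
      congr 1
      · ring
      · congr 1
        ring
    have h2 : σ (b • a) = (σ' ^ p) b • σ a := by
      rw [Algebra.smul_def, _root_.map_mul, hσF, Algebra.smul_def]
    rw [h1, h2, hθ', TensorProduct.tmul_add, TensorProduct.add_tmul, TensorProduct.smul_tmul,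
      smul_mul_assoc, TensorProduct.smul_tmul, TensorProduct.smul_tmul, smul_assoc, add_assoc]
  let θ₀ : A ⊗[B] M →+ A ⊗[B] M := TensorProduct.liftAddHom Φ hΦ
  have hθ₀ : ∀ a s, θ₀ (a ⊗ₜ s) = D a ⊗ₜ s + (σ a * x ^ (p - 1)) ⊗ₜ θ' s := fun _ _ => rfl
  let θ : A ⊗[B] M →ₗ[R] A ⊗[B] M :=
    { θ₀ with
      map_smul' := fun r z => by
        change θ₀ (r • z) = r • θ₀ z
        induction z using TensorProduct.induction_on with
        | zero => simp
        | add y z hy hz => rw [smul_add, _root_.map_add, hy, hz, _root_.map_add, smul_add]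
        | tmul a s =>
          rw [TensorProduct.smul_tmul', hθ₀, hθ₀, map_smul, map_smul, smul_add,
            TensorProduct.smul_tmul', TensorProduct.smul_tmul', smul_mul_assoc] }
  have hθ : ∀ a s, θ (a ⊗ₜ s) = D a ⊗ₜ s + (σ a * x ^ (p - 1)) ⊗ₜ θ' s := hθ₀
  refine ⟨θ, ⟨fun f z => ?_, fun s => ?_⟩, ?_⟩
  · induction z using TensorProduct.induction_on with
    | zero => simp
    | add y z hy hz =>
      rw [smul_add, _root_.map_add, hy, hz, _root_.map_add, smul_add, smul_add]
      abel
    | tmul a s =>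
      rw [TensorProduct.smul_tmul', hθ, hθ, smul_add, TensorProduct.smul_tmul',
        TensorProduct.smul_tmul', TensorProduct.smul_tmul', smul_eq_mul, smul_eq_mul, smul_eq_mul,
        smul_eq_mul, hD.leibniz, _root_.map_mul, TensorProduct.add_tmul, mul_assoc, add_assoc]
  · change θ ((1 : A) ⊗ₜ s) = (x ^ (p - 1)) ⊗ₜ θ' s
    rw [hθ, hD.map_one, _root_.map_one, one_mul, TensorProduct.zero_tmul, zero_add]
  · rintro η ⟨hη, hη1⟩
    ext z
    induction z using TensorProduct.induction_on with
    | zero => simp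
    | add y z hy hz => rw [_root_.map_add, hy, hz, _root_.map_add]
    | tmul a s => rw [hη.map_tmul hη1, hθ]

end ModulePullback

/-! ### Homotopy equivalences of two-term complexes. -/

section TwoTerm

variable {R : Type u} [CommRing R] {M₀ M₁ N₀ N₁ : Type u}
  [AddCommGroup M₀] [AddCommGroup M₁] [AddCommGroup N₀] [AddCommGroup N₁]
  [Module R M₀] [Module R M₁] [Module R N₀] [Module R N₁]

theorem isZero_twoTermComplex_X (d : M₀ →ₗ[R] M₁) (n : ℕ) :
    Limits.IsZero ((twoTermComplex d).X (n + 2)) :=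
  HomologicalComplex.isZero_double_X _ _ _ (by simp) (by simp)

theorem twoTermMap_comp_eq_id {d : M₀ →ₗ[R] M₁} {e : N₀ →ₗ[R] N₁} {f₀ : M₀ →ₗ[R] N₀}
    {f₁ : M₁ →ₗ[R] N₁} (comm : ∀ s, e (f₀ s) = f₁ (d s)) {g₀ : N₀ →ₗ[R] M₀} {g₁ : N₁ →ₗ[R] M₁}
    (comm' : ∀ s, d (g₀ s) = g₁ (e s)) (h₀ : ∀ s, g₀ (f₀ s) = s) (h₁ : ∀ s, g₁ (f₁ s) = s) :
    twoTermMap d e f₀ f₁ comm ≫ twoTermMap e d g₀ g₁ comm' = 𝟙 _ := by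
  have h₀' : ModuleCat.ofHom f₀ ≫ ModuleCat.ofHom g₀ = 𝟙 _ := by ext s; exact h₀ s
  have h₁' : ModuleCat.ofHom f₁ ≫ ModuleCat.ofHom g₁ = 𝟙 _ := by ext s; exact h₁ s
  refine HomologicalComplex.from_double_hom_ext ?_ ?_
  · simp [twoTermMap, HomologicalComplex.mkHomFromDouble_f₀, reassoc_of% h₀']
  · simp [twoTermMap, HomologicalComplex.mkHomFromDouble_f₁, reassoc_of% h₁']

/-- The homotopy from a composition of morphisms of two-term complexes to the identity given by
a map from degree `1` to degree `0`. -/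
noncomputable def twoTermMapCompHomotopy {d : M₀ →ₗ[R] M₁} {e : N₀ →ₗ[R] N₁} {f₀ : M₀ →ₗ[R] N₀}
    {f₁ : M₁ →ₗ[R] N₁} (comm : ∀ s, e (f₀ s) = f₁ (d s)) {g₀ : N₀ →ₗ[R] M₀} {g₁ : N₁ →ₗ[R] M₁}
    (comm' : ∀ s, d (g₀ s) = g₁ (e s)) (h : M₁ →ₗ[R] M₀)
    (h₀ : ∀ s, h (d s) = s - g₀ (f₀ s)) (h₁ : ∀ s, d (h s) = s - g₁ (f₁ s)) :
    Homotopy (𝟙 (twoTermComplex d)) (twoTermMap d e f₀ f₁ comm ≫ twoTermMap e d g₀ g₁ comm') where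
  hom i j := match i, j with
    | 1, 0 => (HomologicalComplex.doubleXIso₁ (ModuleCat.ofHom d) up_rel_zero_one zero_ne_one).hom ≫
        ModuleCat.ofHom h ≫
          (HomologicalComplex.doubleXIso₀ (ModuleCat.ofHom d) up_rel_zero_one).inv
    | _, _ => 0
  zero i j hij := by
    split
    · exact absurd rfl hij
    · rfl
  comm i := by
    have h₀' : ModuleCat.ofHom d ≫ ModuleCat.ofHom h =
        𝟙 _ - ModuleCat.ofHom f₀ ≫ ModuleCat.ofHom g₀ := by ext s; exact h₀ s
    have h₁' : ModuleCat.ofHom h ≫ ModuleCat.ofHom d =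
        𝟙 _ - ModuleCat.ofHom f₁ ≫ ModuleCat.ofHom g₁ := by ext s; exact h₁ s
    match i with
    | 0 =>
      rw [dNext_eq _ up_rel_zero_one, prevD_eq_zero _ _ (by simp), add_zero,
        HomologicalComplex.double_d _ _ zero_ne_one]
      simp [twoTermMap, HomologicalComplex.mkHomFromDouble_f₀, reassoc_of% h₀']
    | 1 =>
      rw [prevD_eq _ up_rel_zero_one, dNext_eq _ (show (ComplexShape.up ℕ).Rel 1 2 from rfl),
        HomologicalComplex.double_d _ _ zero_ne_one]
      simp [twoTermMap, HomologicalComplex.mkHomFromDouble_f₁, reassoc_of% h₁']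
    | n + 2 => exact (isZero_twoTermComplex_X d n).eq_of_src _ _

theorem quasiIso_twoTermMap {d : M₀ →ₗ[R] M₁} {e : N₀ →ₗ[R] N₁} {f₀ : M₀ →ₗ[R] N₀}
    {f₁ : M₁ →ₗ[R] N₁} (comm : ∀ s, e (f₀ s) = f₁ (d s)) (g₀ : N₀ →ₗ[R] M₀) (g₁ : N₁ →ₗ[R] M₁)
    (h : N₁ →ₗ[R] N₀) (comm' : ∀ s, d (g₀ s) = g₁ (e s)) (hg₀ : ∀ s, g₀ (f₀ s) = s)
    (hg₁ : ∀ s, g₁ (f₁ s) = s) (h₀ : ∀ s, h (e s) = s - f₀ (g₀ s))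
    (h₁ : ∀ s, e (h s) = s - f₁ (g₁ s)) : QuasiIso (twoTermMap d e f₀ f₁ comm) := by
  let E : HomotopyEquiv (twoTermComplex d) (twoTermComplex e) :=
    { hom := twoTermMap d e f₀ f₁ comm
      inv := twoTermMap e d g₀ g₁ comm'
      homotopyHomInvId := Homotopy.ofEq (twoTermMap_comp_eq_id comm comm' hg₀ hg₁)
      homotopyInvHomId := (twoTermMapCompHomotopy comm' comm h h₀ h₁).symm }
  exact E.quasiIso_hom

end TwoTerm

/-! ### Contraction of the complementary summands. -/

section ModulePullback

variable {p : ℕ} {R A B M : Type*} [CommRing R] [CommRing A] [CommRing B] [Algebra R A]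
  [Algebra R B] [Algebra B A] [IsScalarTower R B A] [AddCommGroup M] [Module R M] [Module B M]
  [IsScalarTower R B M] {q : R} {x : A} {x' : B} {σ : A →ₐ[R] A} {D : A →ₗ[R] A}
  {σ' : B →ₐ[R] B} {D' : B →ₗ[R] B} {θ' : M →ₗ[R] M}

/-- The coordinates of a tensor product with respect to a finite basis of the left factor. -/
noncomputable def tensorCoord {ι : Type*} [Finite ι] (b : Module.Basis ι B A) :
    A ⊗[B] M ≃ₗ[B] (ι → M) := by
  classical exact (TensorProduct.equivFinsuppOfBasisLeft b).trans (Finsupp.linearEquivFunOnFinite B M ι)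

theorem tensorCoord_symm {ι : Type*} [Fintype ι] (b : Module.Basis ι B A) (c : ι → M) :
    (tensorCoord b).symm c = ∑ i, b i ⊗ₜ[B] c i := by
  classical
  simp only [tensorCoord, LinearEquiv.trans_symm, LinearEquiv.trans_apply,
    TensorProduct.equivFinsuppOfBasisLeft_symm_apply]
  rw [Finsupp.sum_fintype _ _ (by simp)]
  rfl

/-- In the basis `x ^ i`, the operator `θ` lowers the exponent by one through the bijections `(i)_q
+ q ^ i x' θ'`, except that it sends exponent `0` to the top exponent through `θ'`. The retractions
`g₀` and `g₁` read off the bottom and top coefficients, and `h` inverts the lowering part. Here `m +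
1` is `p`. -/
theorem exists_contraction {m : ℕ} [IsAdicComplete (qIdeal (m + 1) q B) M]
    (hunit : ∀ i, 0 < i → i < m + 1 → IsUnit (qNumber q i))
    (b : Module.Basis (Fin (m + 1)) B A) (hb : ∀ i, b i = x ^ (i : ℕ))
    (hx' : algebraMap B A x' = x ^ (m + 1)) (hσ : σ x = algebraMap R A q * x)
    (hD : IsTwistedDerivative σ x D)
    (hσ' : (σ' ^ (m + 1)) x' = algebraMap R B (q ^ (m + 1)) * x')
    (hθ' : IsTwistedConnectionNegOne (m + 1) q σ' D' θ')
    (hnil : IsTopQuasiNilpotent (qIdeal (m + 1) q B) θ')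
    {θ : A ⊗[B] M →ₗ[R] A ⊗[B] M} (hθ : IsTwistedConnection σ D θ)
    (hθ1 : ∀ s, θ (tensorLeft R 1 s) = tensorLeft R (x ^ m) (θ' s)) :
    ∃ (g₀ g₁ : A ⊗[B] M →ₗ[R] M) (h : A ⊗[B] M →ₗ[R] A ⊗[B] M),
      (∀ z, θ' (g₀ z) = g₁ (θ z)) ∧ (∀ s, g₀ (tensorLeft R 1 s) = s) ∧
      (∀ s, g₁ (tensorLeft R (x ^ m) s) = s) ∧ (∀ z, h (θ z) = z - tensorLeft R 1 (g₀ z)) ∧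
      ∀ z, θ (h z) = z - tensorLeft R (x ^ m) (g₁ z) := by
  have := isAdicComplete_span_of_qIdeal (p := m + 1) (q := q) (R := R) (B := B) (M := M)
  let κ := tensorCoord (M := M) b
  have hκ : ∀ c : Fin (m + 1) → M, κ (∑ i : Fin (m + 1), (x ^ (i : ℕ)) ⊗ₜ[B] c i) = c := fun c => by
    have := tensorCoord_symm b c
    simp only [hb] at this
    rw [← this, LinearEquiv.apply_symm_apply]
  have hz : ∀ z, z = ∑ i : Fin (m + 1), (x ^ (i : ℕ)) ⊗ₜ[B] κ z i := fun z => by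
    have := tensorCoord_symm b (κ z)
    simp only [hb] at this
    rw [← this, LinearEquiv.symm_apply_apply]
  let T : M →ₗ[R] M := Module.toModuleEnd R (S := B) M x' * θ'
  -- The index is shifted: `u i` is the component from exponent `i + 1` to exponent `i`, so the
  -- `q`-numbers involved are `(1)_q, …, (m)_q`, all units.
  let u : Fin m → M →ₗ[R] M := fun i => qNumber q (i + 1) • (1 : M →ₗ[R] M) + q ^ (i + 1 : ℕ) • T
  have hu : ∀ i, Function.Bijective (u i) := fun i =>
    LinearMap.bijective_smul_one_add_of_topologically_nilpotent
      (hunit (i + 1) (Nat.succ_pos _) (Nat.succ_lt_succ i.2))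
      fun s => hθ'.exists_pow_mem hσ' hnil _ s
  have hθ0 : ∀ s, θ ((1 : A) ⊗ₜ s) = (x ^ m) ⊗ₜ θ' s := hθ1
  have hθi : ∀ (i : Fin m) s, θ ((x ^ (i + 1 : ℕ)) ⊗ₜ s) = (x ^ (i : ℕ)) ⊗ₜ u i s := fun i s => by
    rw [hθ.map_tmul (p := m + 1) hθ1, hD.map_pow hσ]
    -- `x ^ (i + 1) x ^ m = x ^ i x ^ (m + 1)`, and the last factor is `x'`, which moves across the
    -- tensor product.
    have h1 : σ (x ^ (i + 1 : ℕ)) * x ^ (m + 1 - 1) = q ^ (i + 1 : ℕ) • x' • x ^ (i : ℕ) := by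
      rw [_root_.map_pow, hσ, mul_pow, ← _root_.map_pow, Nat.add_sub_cancel, Algebra.smul_def,
        Algebra.smul_def x', hx', mul_assoc]
      congr 1
      ring
    have h2 : u i s = qNumber q (i + 1) • s + q ^ (i + 1 : ℕ) • x' • θ' s := rfl
    rw [h1, h2, TensorProduct.tmul_add, TensorProduct.tmul_smul, TensorProduct.tmul_smul,
      TensorProduct.tmul_smul]
    rfl
  have hθz : ∀ z, θ z = ∑ i : Fin (m + 1), (x ^ (i : ℕ)) ⊗ₜ[B]
      (Fin.snoc (α := fun _ => M) (fun i => u i (κ z i.succ)) (θ' (κ z 0)) : Fin (m + 1) → M) i := by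
    intro z
    conv_lhs => rw [hz z, Fin.sum_univ_succ, _root_.map_add, _root_.map_sum]
    conv_rhs => rw [Fin.sum_univ_castSucc]
    simp only [Fin.snoc_castSucc, Fin.snoc_last, Fin.val_zero, pow_zero, hθ0, Fin.val_succ, hθi,
      Fin.val_castSucc, Fin.val_last]
    rw [add_comm]
  let v : Fin m → M ≃ₗ[R] M := fun i => LinearEquiv.ofBijective (u i) (hu i)
  have hv : ∀ i s, (v i).symm (u i s) = s := fun i s => (v i).symm_apply_apply s
  have huv : ∀ i s, u i ((v i).symm s) = s := fun i s => (v i).apply_symm_apply s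
  let g : Fin (m + 1) → A ⊗[B] M →ₗ[R] M := fun i =>
    LinearMap.proj i ∘ₗ (κ.toLinearMap.restrictScalars R)
  have hg : ∀ i z, g i z = κ z i := fun _ _ => rfl
  -- Raises the exponent by one and drops the top coefficient, which is the part retained by `g₁`.
  let h : A ⊗[B] M →ₗ[R] A ⊗[B] M := ∑ i : Fin m,
    tensorLeft R (x ^ (i + 1 : ℕ)) ∘ₗ (v i).symm.toLinearMap ∘ₗ g i.castSucc
  have hh : ∀ z, h z = ∑ i : Fin m, (x ^ (i + 1 : ℕ)) ⊗ₜ[B] (v i).symm (κ z i.castSucc) := fun z => by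
    simp only [h, LinearMap.sum_apply]
    rfl
  refine ⟨g 0, g (Fin.last m), h, fun z => ?_, fun s => ?_, fun s => ?_, fun z => ?_, fun z => ?_⟩
  · rw [hg, hg, hθz, hκ, Fin.snoc_last]
  · have : tensorLeft R (1 : A) s =
        ∑ i : Fin (m + 1), (x ^ (i : ℕ)) ⊗ₜ[B] (Pi.single 0 s : Fin (m + 1) → M) i := by
      rw [Finset.sum_eq_single 0 (fun i _ hi => by rw [Pi.single_eq_of_ne hi, TensorProduct.tmul_zero])
        (by simp)]
      simp [tensorLeft]
    rw [hg, this, hκ, Pi.single_eq_same]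
  · have : tensorLeft R (x ^ m) s =
        ∑ i : Fin (m + 1), (x ^ (i : ℕ)) ⊗ₜ[B] (Pi.single (Fin.last m) s : Fin (m + 1) → M) i := by
      rw [Finset.sum_eq_single (Fin.last m)
        (fun i _ hi => by rw [Pi.single_eq_of_ne hi, TensorProduct.tmul_zero]) (by simp)]
      simp [tensorLeft]
    rw [hg, this, hκ, Pi.single_eq_same]
  · rw [hh, hθz, hκ]
    simp only [Fin.snoc_castSucc, hv]
    rw [eq_sub_iff_add_eq, hg]
    conv_rhs => rw [hz z, Fin.sum_univ_succ, add_comm]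
    simp [tensorLeft]
  · rw [hh, _root_.map_sum]
    simp only [hθi, huv]
    rw [eq_sub_iff_add_eq, hg]
    conv_rhs => rw [hz z, Fin.sum_univ_castSucc]
    simp [tensorLeft]

end ModulePullback

theorem theorem6 {p : ℕ} [Fact p.Prime]
    -- the base `R` and the complete `R`-algebra `A` with topologically étale coordinate `x`
    {R : Type u} [CommRing R] (δR : DeltaStructure p R) (q : R) (hq : IsQBase p δR q)
    {A : Type u} [CommRing A] [Algebra R A] [IsAdicComplete (qIdeal p q A) A]
    (x : A) (hx : IsTopEtaleCoordinate (Ideal.span {(p : R), q - 1}) x)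
    (δA : DeltaStructure p A)
    (hδA : ∀ r : R, δA.δ (algebraMap R A r) = algebraMap R A (δR.δ r)) (hδx : δA.δ x = 0)
    -- `σ` and the `q`-derivative on `A`
    (σ : A →ₐ[R] A) (hσ : IsQEndomorphism q x σ)
    (D : A →ₗ[R] A) (hD : IsTwistedDerivative σ x D)
    -- `σ` and the `q ^ p`-derivative on `A'`, for the coordinate `x' = 1 ⊗ x`
    (σ' : FrobeniusPullback δR q A →ₐ[R] FrobeniusPullback δR q A)
    (hσ' : IsQEndomorphism q (FrobeniusPullback.incl δR q x) σ')
    (D' : FrobeniusPullback δR q A →ₗ[R] FrobeniusPullback δR q A)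
    (hD' : IsTwistedDerivative (σ' ^ p) (FrobeniusPullback.incl δR q x) D')
    -- `A` is an `A'`-algebra through the relative Frobenius
    [Algebra (FrobeniusPullback δR q A) A] [IsScalarTower R (FrobeniusPullback δR q A) A]
    (hF : algebraMap (FrobeniusPullback δR q A) A = relativeFrobenius δR q δA hδA)
    -- the module `M'` with its connection
    {M' : Type u} [AddCommGroup M'] [Module R M'] [Module (FrobeniusPullback δR q A) M']
    [IsScalarTower R (FrobeniusPullback δR q A) M']
    [IsAdicComplete (qIdeal p q (FrobeniusPullback δR q A)) M']
    (hM' : IsFormallyFlat (qIdeal p q (FrobeniusPullback δR q A)) M')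
    (θ' : M' →ₗ[R] M') (hθ' : IsTwistedConnectionNegOne p q σ' D' θ')
    (hnil : IsTopQuasiNilpotent (qIdeal p q (FrobeniusPullback δR q A)) θ') :
    -- the induced connection of level `0` on `M = A ⊗ M'`
    (∃! θ : (A ⊗[FrobeniusPullback δR q A] M') →ₗ[R] (A ⊗[FrobeniusPullback δR q A] M'),
      IsTwistedConnection σ D θ ∧
        ∀ s : M', θ (tensorLeft R 1 s) = tensorLeft R (x ^ (p - 1)) (θ' s)) ∧
    ∀ (θ : (A ⊗[FrobeniusPullback δR q A] M') →ₗ[R] (A ⊗[FrobeniusPullback δR q A] M'))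
      (_ : IsTwistedConnection σ D θ)
      (comm : ∀ s : M', θ (tensorLeft R 1 s) = tensorLeft R (x ^ (p - 1)) (θ' s)),
      QuasiIso (twoTermMap θ' θ (tensorLeft R 1) (tensorLeft R (x ^ (p - 1))) comm) := by

  have hF' := algebraMap_incl_coordinate hδA hδx hF
  have hσF := endomorphism_algebraMap hq.delta_q hx hF' hσ hσ'
  have hDF := derivative_algebraMap hq.delta_q hx hF' hσ hσ' hD hD'
  refine ⟨existsUnique_isTwistedConnection hσF hDF hD hθ', fun θ hθ comm => ?_⟩
  obtain ⟨b, hb⟩ := exists_basis_relativeFrobenius hδA hq.delta_q hx hδx hF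
  have hunit := fun i => hq.isUnit_qNumber (i := i)
  have hσx := hσ'.pow_map_coordinate p
  obtain ⟨m, hm⟩ : ∃ m, p = m + 1 := Nat.exists_eq_succ_of_ne_zero (Fact.out : p.Prime).ne_zero
  obtain ⟨g₀, g₁, h, h1, h2, h3, h4, h5⟩ : ∃ (g₀ g₁ : (A ⊗[FrobeniusPullback δR q A] M') →ₗ[R] M')
      (h : (A ⊗[FrobeniusPullback δR q A] M') →ₗ[R] (A ⊗[FrobeniusPullback δR q A] M')),
      (∀ z, θ' (g₀ z) = g₁ (θ z)) ∧ (∀ s, g₀ (tensorLeft R 1 s) = s) ∧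
      (∀ s, g₁ (tensorLeft R (x ^ (p - 1)) s) = s) ∧
      (∀ z, h (θ z) = z - tensorLeft R 1 (g₀ z)) ∧
      ∀ z, θ (h z) = z - tensorLeft R (x ^ (p - 1)) (g₁ z) := by
    -- After the substitution `p - 1` reads `m + 1 - 1`, which is `m` by definition.
    subst hm
    exact exists_contraction hunit b hb hF' hσ.map_coordinate hD hσx hθ' hnil hθ comm
  exact quasiIso_twoTermMap comm g₀ g₁ h h1 h2 h3 h4 h5
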